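/- **Theorem.** ${\rm QMA}_{{\rm postBQP}_{\rm FP}}\subseteq{\rm SBQP}$, where the two classes of languages $L\subseteq\{0,1\}^*$ are defined as follows. *Circuits.* A quantum circuit is a sequence of gates from the fixed gate set $\{H,\ T={\rm diag}(1,e^{i\pi/4}),\ X,\ {\rm CNOT},\ {\rm Toffoli}\}$. It acts on a register of input qubits, which receive a (pure or mixed) witness state, followed by a register of ancilla qubits initialized in $|0\rangle$. There are at least two qubits in total. At the end all qubits are measured in the computational basis; the value of the first qubit is the output $o$, and the value of the second is the postselection bit $p$. $P_{Q(\xi)}$ denotes the probability of an event when the circuit $Q$ is run on the witness $\xi$. A family $\{Q_x\}_{x\in\{0,1\}^*}$ of circuits is uniform if a deterministic Turing machine maps $x$ to a description of $Q_x$ (its register sizes and its list of gates, with numbers in unary) in time polynomial in $n=|x|$; in particular, $Q_x$ then has polynomial size. Polynomials have coefficients in $\mathbb N$. *${\rm QMA}_{{\rm postBQP}_{\rm FP}}$.* $L$ is in ${\rm QMA}_{{\rm postBQP}_{\rm FP}}$ if and only if there exist polynomials $w,m,s$ and a uniform family $\{Q_x\}_x$ of quantum circuits, where $Q_x$ takes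 a $w(n)$-qubit witness and has $m(n)$ ancilla qubits, such that for every $x$, with $n=|x|$, $$P_{Q_x(\xi)}(p=1)=2^{-s(n)}\quad\text{for every } w(n)\text{-qubit state }\xi,$$ and - if $x\in L$, then there is a $w(n)$-qubit state $\psi$ with $P_{Q_x(\psi)}(o=1\mid p=1)\ge\frac23$; - if $x\notin L$, then $P_{Q_x(\xi)}(o=1\mid p=1)\le\frac13$ for every $w(n)$-qubit state $\xi$. *${\rm SBQP}$.* $L$ is in ${\rm SBQP}$ if and only if there exist a polynomial $r$ and a uniform family $\{Q_x\}_x$ of quantum circuits without witness (all qubits are initialized in $|0\rangle$) such that for every $x$, with $n=|x|$, - if $x\in L$, then $P_{Q_x}(o=1)\ge2^{-r(n)}$; - if $x\notin L$, then $P_{Q_x}(o=1)\le2^{-r(n)-1}$. -/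

import Mathlib

/-! # Quantum circuits, polynomial-time uniformity, and two complexity classes -/

namespace MerlinQC

open Matrix
open scoped ComplexOrder

/-- A gate acting on `N` qubits, from the fixed gate set: Hadamard, `T = diag (1, exp (iπ/4))`,
`X`, controlled-not and Toffoli. The arguments say which (distinct) qubits it acts on; the last
argument of `cnot` and `toffoli` is the target. -/
inductive Gate (N : ℕ) : Type where
  | hadamard (i : Fin N) : Gate N
  | tGate (i : Fin N) : Gate N
  | xGate (i : Fin N) : Gate N
  | cnot (c t : Fin N) (hct : c ≠ t) : Gate N
  | toffoli (a b t : Fin N) (hab : a ≠ b) (hat : a ≠ t) (hbt : b ≠ t) : Gate N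

/-- Operators on `N` qubits, as matrices in the computational basis `Fin N → Bool`. -/
abbrev Op (N : ℕ) : Type := Matrix (Fin N → Bool) (Fin N → Bool) ℂ

/-- The unitary matrix of a gate. The entry at `(b, c)` is `⟨b| g |c⟩`. -/
noncomputable def Gate.matrix {N : ℕ} : Gate N → Op N
  | .hadamard i => Matrix.of fun b c =>
      if ∀ j, j ≠ i → b j = c j then
        (((Real.sqrt 2)⁻¹ : ℝ) : ℂ) * (if b i = true ∧ c i = true then -1 else 1)
      else 0
  | .tGate i => Matrix.diagonal fun b =>
      if b i = true then Complex.exp (Complex.I * (Real.pi : ℂ) / 4) else 1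
  | .xGate i => Matrix.of fun b c =>
      if b = Function.update c i (!(c i)) then 1 else 0
  | .cnot k t _ => Matrix.of fun b c =>
      if b = Function.update c t (xor (c t) (c k)) then 1 else 0
  | .toffoli k l t _ _ _ => Matrix.of fun b c =>
      if b = Function.update c t (xor (c t) (c k && c l)) then 1 else 0

/-- A quantum circuit, with a register of `witness` input qubits followed by `ancilla` qubits
initialised in `|0⟩`; the gates are applied in the order of the list. There are at least two
qubits: qubit `0` is the output qubit `o`, and qubit `1` is the postselection qubit `p`. -/
structure Circuit : Type where
  witness : ℕ
  ancilla : ℕ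
  two_le : 2 ≤ witness + ancilla
  gates : List (Gate (witness + ancilla))

/-- The total number of qubits of a circuit. -/
abbrev Circuit.width (C : Circuit) : ℕ := C.witness + C.ancilla

/-- The unitary matrix of a circuit (the head of the list of gates acts first). -/
noncomputable def Circuit.unitary (C : Circuit) : Op C.width :=
  C.gates.foldl (fun U g => g.matrix * U) 1

/-- Density matrices: the (pure or mixed) states of `N` qubits. -/
def IsState {N : ℕ} (ρ : Op N) : Prop := ρ.PosSemidef ∧ ρ.trace = 1

/-- The state `|0…0⟩⟨0…0|` of `N` qubits. -/
def zeroState (N : ℕ) : Op N := Matrix.of fun b c =>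
  if (∀ i, b i = false) ∧ (∀ i, c i = false) then 1 else 0

/-- The initial state `ξ ⊗ |0…0⟩⟨0…0|` of a circuit: the first `witness` qubits are in the state
`ξ`, and the ancilla qubits are in the state `|0⟩`. -/
def Circuit.input (C : Circuit) (ξ : Op C.witness) : Op C.width := Matrix.of fun b c =>
  ξ (fun i => b (Fin.castAdd C.ancilla i)) (fun i => c (Fin.castAdd C.ancilla i)) *
    zeroState C.ancilla (fun j => b (Fin.natAdd C.witness j)) (fun j => c (Fin.natAdd C.witness j))

/-- The probability that running `C` on the initial state `ρ` and measuring all qubits in the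
computational basis gives an outcome in the event `E`. -/
noncomputable def Circuit.prob (C : Circuit) (ρ : Op C.width)
    (E : (Fin C.width → Bool) → Bool) : ℝ :=
  (∑ b, if E b = true then (C.unitary * ρ * C.unitaryᴴ) b b else 0).re

/-- The value of the output qubit. -/
def Circuit.o (C : Circuit) (b : Fin C.width → Bool) : Bool :=
  b ⟨0, lt_of_lt_of_le Nat.zero_lt_two C.two_le⟩

/-- The value of the postselection qubit. -/
def Circuit.p (C : Circuit) (b : Fin C.width → Bool) : Bool :=
  b ⟨1, lt_of_lt_of_le Nat.one_lt_two C.two_le⟩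

/-- The postselection probability `P(p = 1)` for the witness `ξ`. -/
noncomputable def Circuit.postProb (C : Circuit) (ξ : Op C.witness) : ℝ :=
  C.prob (C.input ξ) C.p

/-- The conditional probability `P(o = 1 | p = 1)` for the witness `ξ`. -/
noncomputable def Circuit.condProb (C : Circuit) (ξ : Op C.witness) : ℝ :=
  C.prob (C.input ξ) (fun b => C.o b && C.p b) / C.postProb ξ

/-- The probability `P(o = 1)` when all qubits are initialised in `|0⟩`. -/
noncomputable def Circuit.acceptProb (C : Circuit) : ℝ :=
  C.prob (zeroState C.width) C.o

/-- The finite alphabet in which circuits are written down. -/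
inductive Sym : Type where
  | tick | sep | symH | symT | symX | symC | symF

/-- A natural number in unary. -/
def encodeNat (n : ℕ) : List Sym := List.replicate n Sym.tick ++ [Sym.sep]

/-- The description of a gate: its type, then the qubits that it acts on. -/
def Gate.encode {N : ℕ} : Gate N → List Sym
  | .hadamard i => Sym.symH :: encodeNat i
  | .tGate i => Sym.symT :: encodeNat i
  | .xGate i => Sym.symX :: encodeNat i
  | .cnot c t _ => Sym.symC :: (encodeNat c ++ encodeNat t)
  | .toffoli a b t _ _ _ => Sym.symF :: (encodeNat a ++ encodeNat b ++ encodeNat t)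

/-- The description of a circuit: the sizes of its two registers, then its gates in order. -/
def Circuit.encode (C : Circuit) : List Sym :=
  encodeNat C.witness ++ encodeNat C.ancilla ++ C.gates.flatMap Gate.encode

/-- A family of circuits indexed by the instances `x` is (polynomial-time) uniform if some
deterministic Turing machine maps `x` to the description of `Q x` in time polynomial in `|x|`.
In particular `Q x` has polynomially many qubits and gates. -/
def Uniform (Q : List Bool → Circuit) : Prop :=
  Nonempty (Turing.TM2ComputableInPolyTime (id : List Bool → List Bool) Circuit.encode Q)

/-- The polynomials `w`, `m`, `s` and the uniform family `Q` witness that the language `L` is in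
`QMA_postBQP`. -/
structure IsPostVerifier (L : Language Bool) (w m s : Polynomial ℕ) (Q : List Bool → Circuit) :
    Prop where
  uniform : Uniform Q
  witness_eq : ∀ x, (Q x).witness = w.eval x.length
  ancilla_eq : ∀ x, (Q x).ancilla = m.eval x.length
  post_ge : ∀ x, ∀ ξ : Op (Q x).witness, IsState ξ →
    1 / 2 ^ s.eval x.length ≤ (Q x).postProb ξ
  yes : ∀ x ∈ L, ∃ ψ : Op (Q x).witness, IsState ψ ∧ 2 / 3 ≤ (Q x).condProb ψ
  no : ∀ x ∉ L, ∀ ξ : Op (Q x).witness, IsState ξ → (Q x).condProb ξ ≤ 1 / 3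

/-- The class `QMA_{postBQP_FP}`: as `QMA_postBQP`, and the postselection probability is exactly
`2 ^ (- s(n))` for every witness state. -/
def QMApostBQPFP : Set (Language Bool) :=
  {L | ∃ (w m s : Polynomial ℕ) (Q : List Bool → Circuit), IsPostVerifier L w m s Q ∧
    ∀ x, ∀ ξ : Op (Q x).witness, IsState ξ → (Q x).postProb ξ = 1 / 2 ^ s.eval x.length}

/-- The class `SBQP`; its circuits have no witness. -/
def SBQP : Set (Language Bool) :=
  {L | ∃ (r : Polynomial ℕ) (Q : List Bool → Circuit), Uniform Q ∧
    (∀ x, (Q x).witness = 0) ∧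
    (∀ x ∈ L, 1 / 2 ^ r.eval x.length ≤ (Q x).acceptProb) ∧
    (∀ x ∉ L, (Q x).acceptProb ≤ 1 / 2 ^ (r.eval x.length + 1))}

end MerlinQC

/-! Let `U` be the circuit's unitary, `E` the isometry that adds the ancillas in `|0⟩`, and `Π` the
projection to `o = p = 1`. The operator `A = Eᴴ Uᴴ Π U E` on witnesses (`acceptOp`) is positive
semidefinite, and `tr (A ξ)` is the probability of `o = p = 1` on the witness `ξ`
(`Circuit.prob_input`). Because the postselection probability is exactly `2^(-s)`, this joint
probability is the conditional one times `2^(-s)`. So in the yes case `A` has an eigenvalue at least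
`(2/3) 2^(-s)`, and in the no case all its eigenvalues are at most `(1/3) 2^(-s)`.

An SBQP circuit has no witness, so the maximally mixed state is used instead, as halves of `w` Bell
pairs. This costs a factor `2^w` between the largest eigenvalue and the trace, which is compensated
by amplification on the same witness: a round runs `U`, projects with `Π`, runs `Uᴴ`, and projects
the ancillas back to `|0⟩`. On the range of `E` a round acts as `A` (`roundVec_embedding`), so after
`w + 1` rounds the success probability is `2^(-w) tr (A^(2(w+1)))` (`Circuit.acceptProb_amplify`).
The eigenvalue bounds become trace bounds by `re_trace_pow_ge` and `re_trace_pow_le`, and the gap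
`2/3` against `1/3`, raised to the power `2(w+1)`, outweighs `2^w`.

The projections are made coherent by a chain of fresh qubits: a Toffoli gate sets the next chain
qubit to the conjunction of the previous one and the tested qubit, so the last one is `1` exactly in
the branch that passed every test. The invariant is `ChainState`; failed branches need not be
described. Every gate satisfies `g^8 = 1`, so the inverse circuit repeats each gate seven times in
reverse order.

It remains that the new family is uniform. A small language of stack programs is compiled to stack
machines and composed with the given machine (`polyTime_comp`); an explicit program in it rewrites
the description of a circuit into that of the amplified one in polynomial time (`runs_amplifyProg`).
-/

/-! ### A small programming language for stack machines -/

namespace StackProg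

open Turing Function

/-- `ReachesIn f n a b`: iterating the partial map `f` exactly `n` times leads from `a` to `b`. -/
def ReachesIn {α : Type*} (f : α → Option α) (n : ℕ) (a b : α) : Prop :=
  (flip bind f)^[n] (some a) = some b

theorem ReachesIn.trans {α : Type*} {f : α → Option α} {m n : ℕ} {a b c : α}
    (h₁ : ReachesIn f m a b) (h₂ : ReachesIn f n b c) : ReachesIn f (m + n) a c := by
  unfold ReachesIn at *
  rw [add_comm, iterate_add_apply, h₁, h₂]

theorem ReachesIn.single {α : Type*} {f : α → Option α} {a b : α} (h : f a = some b) :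
    ReachesIn f 1 a b := by
  simpa [ReachesIn, flip] using h

theorem iterate_bind_none {α : Type*} (f : α → Option α) (n : ℕ) :
    (flip bind f)^[n] none = none := by
  induction n with
  | zero => rfl
  | succ n ih => rw [iterate_succ_apply]; exact ih

theorem reachesIn_succ {α : Type*} {f : α → Option α} {n : ℕ} {a c : α} :
    ReachesIn f (n + 1) a c ↔ ∃ b, f a = some b ∧ ReachesIn f n b c := by
  unfold ReachesIn
  rw [iterate_succ_apply]
  change (flip bind f)^[n] (f a) = some c ↔ _
  cases h : f a with
  | none => rw [iterate_bind_none]; simp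
  | some b => simp

/-- Programs acting on stacks indexed by `κ` with entries in `A`. The program `loop k c body` pops
the stack `k`; if it finds an element `a` with `c a`, then it runs `body a` and starts again,
otherwise it stops. -/
inductive Prog (κ A : Type) : Type
  | skip : Prog κ A
  | push (k : κ) (a : A) : Prog κ A
  | seq (p q : Prog κ A) : Prog κ A
  | loop (k : κ) (c : A → Bool) (body : A → Prog κ A) : Prog κ A

namespace Prog

variable {κ A : Type}

/-- The control locations of a program. -/
def Lab : Prog κ A → Type
  | skip => Unit
  | push _ _ => Unit
  | seq p q => Lab p ⊕ Lab q
  | loop _ _ body => Option (Σ a, Lab (body a))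

/-- The control location at which a program starts. -/
def entry : (p : Prog κ A) → p.Lab
  | skip => ()
  | push _ _ => ()
  | seq p _ => Sum.inl p.entry
  | loop _ _ _ => none

/-- A loop has a copy of its body for every symbol, so the popped symbol is remembered by the
control location; finiteness of the alphabet keeps the compiled machine finite. -/
theorem finite_lab [Finite A] : (p : Prog κ A) → Finite p.Lab
  | skip => inferInstanceAs (Finite Unit)
  | push _ _ => inferInstanceAs (Finite Unit)
  | seq p q =>
    have := finite_lab p
    have := finite_lab q
    inferInstanceAs (Finite (p.Lab ⊕ q.Lab))
  | loop _ _ body =>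
    have := fun a => finite_lab (body a)
    inferInstanceAs (Finite (Option (Σ a, (body a).Lab)))

/-- `Runs p S S' t`: started on the stacks `S`, the program `p` ends with the stacks `S'` after at
most `t` steps. -/
inductive Runs [DecidableEq κ] : Prog κ A → (κ → List A) → (κ → List A) → ℕ → Prop
  | skip (S : κ → List A) : Runs skip S S 1
  | push (k : κ) (a : A) (S : κ → List A) : Runs (push k a) S (update S k (a :: S k)) 1
  | seq {p q : Prog κ A} {S S' S'' : κ → List A} {t t' : ℕ} :
      Runs p S S' t → Runs q S' S'' t' → Runs (seq p q) S S'' (t + t')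
  | loop_exit {k : κ} {c : A → Bool} {body : A → Prog κ A} {S : κ → List A} :
      (S k).head?.any c = false → Runs (loop k c body) S (update S k (S k).tail) 1
  | loop_step {k : κ} {c : A → Bool} {body : A → Prog κ A} {S S' S'' : κ → List A} {a : A}
      {l : List A} {t t' : ℕ} :
      S k = a :: l → c a = true → Runs (body a) (update S k l) S' t →
      Runs (loop k c body) S' S'' t' → Runs (loop k c body) S S'' (t + t' + 1)
  | mono {p : Prog κ A} {S S' : κ → List A} {t t' : ℕ} : Runs p S S' t → t ≤ t' → Runs p S S' t'

/-! ### Compilation of programs to stack machines -/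

section Compile

variable {K₁ : Type} {Γ₁ : K₁ → Type} {σ₁ Λ : Type}

/-- The code of a program, for a machine that has the stacks of the program besides others, and
that has a register for stack entries; `emb` says where the control locations of the program are
placed, and `exit` is the control location that follows the program. -/
def code [Inhabited A] : (p : Prog κ A) → (p.Lab → Λ) → Λ → p.Lab →
    TM2.Stmt (Sum.elim Γ₁ fun _ : κ => A) Λ (σ₁ × Option A)
  | skip, _, exit, _ => .goto fun _ => exit
  | push k a, _, exit, _ => .push (Sum.inr k) (fun _ => a) (.goto fun _ => exit)
  | seq p q, emb, exit, l =>
    match l with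
    | Sum.inl l => p.code (fun l => emb (Sum.inl l)) (emb (Sum.inr q.entry)) l
    | Sum.inr l => q.code (fun l => emb (Sum.inr l)) exit l
  | loop k c body, emb, exit, l =>
    match l with
    | none => .pop (Sum.inr k) (fun v o => (v.1, o))
        (.branch (fun v => v.2.any c)
          (.goto fun v => emb (some ⟨v.2.getD default, (body (v.2.getD default)).entry⟩))
          (.goto fun _ => exit))
    | some ⟨a, l⟩ => (body a).code (fun l => emb (some ⟨a, l⟩)) (emb none) l

/-- Two families of stacks, side by side. -/
def joinStk (S₁ : ∀ k, List (Γ₁ k)) (S₂ : κ → List A) :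
    ∀ k, List (Sum.elim Γ₁ (fun _ : κ => A) k)
  | Sum.inl k => S₁ k
  | Sum.inr k => S₂ k

variable [DecidableEq K₁] [DecidableEq κ]

theorem update_joinStk_inl (S₁ : ∀ k, List (Γ₁ k)) (S₂ : κ → List A) (k : K₁)
    (x : List (Γ₁ k)) :
    update (joinStk S₁ S₂) (Sum.inl k) x = joinStk (update S₁ k x) S₂ := by
  funext j
  rcases j with j | j
  · by_cases h : j = k
    · subst h
      exact (update_self ..).trans (update_self (β := fun k => List (Γ₁ k)) ..).symm
    · exact (update_of_ne (Sum.inl_injective.ne h) ..).trans (update_of_ne h ..).symm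
  · exact update_of_ne Sum.inr_ne_inl ..

theorem update_joinStk_inr (S₁ : ∀ k, List (Γ₁ k)) (S₂ : κ → List A) (k : κ) (x : List A) :
    update (joinStk S₁ S₂) (Sum.inr k) x = joinStk S₁ (update S₂ k x) := by
  funext j
  rcases j with j | j
  · exact update_of_ne Sum.inl_ne_inr ..
  · by_cases h : j = k
    · subst h
      exact (update_self ..).trans (update_self (β := fun _ => List A) ..).symm
    · exact (update_of_ne (Sum.inr_injective.ne h) ..).trans (update_of_ne h ..).symm

/-- The placement `emb` and the location `exit` stay universally quantified in the induction, since
each subprogram sits in the same machine with its own placement and exit. Only the scratch register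
may change; `v` and the foreign stacks `S₁` are untouched. -/
theorem Runs.reachesIn [Inhabited A] {p : Prog κ A} {S S' : κ → List A} {t : ℕ} (h : Runs p S S' t) :
    ∀ (M : Λ → TM2.Stmt (Sum.elim Γ₁ fun _ : κ => A) Λ (σ₁ × Option A)) (emb : p.Lab → Λ)
      (exit : Λ), (∀ l, M (emb l) = p.code emb exit l) → ∀ (v : σ₁) (o : Option A)
      (S₁ : ∀ k, List (Γ₁ k)), ∃ o' n, n ≤ t ∧
        ReachesIn (TM2.step M) n ⟨some (emb p.entry), (v, o), joinStk S₁ S⟩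
          ⟨some exit, (v, o'), joinStk S₁ S'⟩ := by
  induction h with
  | skip S =>
    intro M emb exit hM v o S₁
    refine ⟨o, 1, le_rfl, ReachesIn.single ?_⟩
    rw [TM2.step, hM]
    rfl
  | push k a S =>
    intro M emb exit hM v o S₁
    refine ⟨o, 1, le_rfl, ReachesIn.single ?_⟩
    rw [TM2.step, hM, ← update_joinStk_inr]
    rfl
  | seq _ _ ih₁ ih₂ =>
    intro M emb exit hM v o S₁
    obtain ⟨o₁, n₁, hn₁, h₁⟩ := ih₁ M (fun l => emb (Sum.inl l)) _ (fun l => hM (Sum.inl l)) v o S₁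
    obtain ⟨o₂, n₂, hn₂, h₂⟩ := ih₂ M (fun l => emb (Sum.inr l)) _ (fun l => hM (Sum.inr l)) v o₁ S₁
    exact ⟨o₂, n₁ + n₂, add_le_add hn₁ hn₂, h₁.trans h₂⟩
  | @loop_exit k c body S hS =>
    intro M emb exit hM v o S₁
    refine ⟨(S k).head?, 1, le_rfl, ReachesIn.single ?_⟩
    rw [TM2.step, hM, ← update_joinStk_inr]
    simp only [entry, code, TM2.stepAux]
    change some (cond ((S k).head?.any c) _ _) = _
    rw [hS]
    rfl
  | @loop_step k c body S S' S'' a l t t' hS hc _ _ ih₁ ih₂ =>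
    intro M emb exit hM v o S₁
    obtain ⟨o₁, n₁, hn₁, h₁⟩ :=
      ih₁ M (fun l => emb (some ⟨a, l⟩)) _ (fun l => hM (some ⟨a, l⟩)) v (some a) S₁
    obtain ⟨o₂, n₂, hn₂, h₂⟩ := ih₂ M emb exit hM v o₁ S₁
    refine ⟨o₂, 1 + n₁ + n₂, by omega, (ReachesIn.trans (ReachesIn.single ?_) h₁).trans h₂⟩
    -- With the popped stack generalized to a variable `x`, its equation can be substituted and the
    -- step computed.
    have key : ∀ (T : ∀ k, List (Sum.elim Γ₁ (fun _ : κ => A) k)) (x : List A), x = a :: l →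
        some (cond (x.head?.any c)
          (⟨some (emb (some ⟨x.head?.getD default, (body (x.head?.getD default)).entry⟩)),
            (v, x.head?), update T (Sum.inr k) x.tail⟩ : TM2.Cfg _ Λ (σ₁ × Option A))
          ⟨some exit, (v, x.head?), update T (Sum.inr k) x.tail⟩) =
        some ⟨some (emb (some ⟨a, (body a).entry⟩)), (v, some a), update T (Sum.inr k) l⟩ := by
      rintro T _ rfl
      change some (cond (c a) _ _) = _
      rw [hc]
      rfl
    rw [TM2.step, hM, ← update_joinStk_inr]
    exact key _ _ hS
  | mono _ ht ih =>
    intro M emb exit hM v o S₁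
    obtain ⟨o', n, hn, h⟩ := ih M emb exit hM v o S₁
    exact ⟨o', n, hn.trans ht, h⟩

end Compile

/-- The largest number of symbols that a single execution of a statement can push. -/
def pushes {K : Type} {Γ : K → Type} {Λ σ : Type} : TM2.Stmt Γ Λ σ → ℕ
  | .push _ _ q => pushes q + 1
  | .peek _ _ q => pushes q
  | .pop _ _ q => pushes q
  | .load _ q => pushes q
  | .branch _ q₁ q₂ => pushes q₁ + pushes q₂
  | .goto _ => 0
  | .halt => 0

theorem length_stepAux_le {K : Type} [DecidableEq K] {Γ : K → Type} {Λ σ : Type}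
    (q : TM2.Stmt Γ Λ σ) (v : σ) (S : ∀ k, List (Γ k)) (k : K) :
    ((TM2.stepAux q v S).stk k).length ≤ (S k).length + pushes q := by
  induction q generalizing v S with
  | push j f q ih =>
    refine (ih _ _).trans ?_
    simp only [pushes]
    by_cases h : k = j
    · subst h
      simp only [update_self, List.length_cons]
      omega
    · rw [update_of_ne h]
      omega
  | peek j f q ih => exact ih _ _
  | pop j f q ih =>
    refine (ih _ _).trans ?_
    simp only [pushes]
    by_cases h : k = j
    · subst h
      simp only [update_self, List.length_tail]
      omega
    · rw [update_of_ne h]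
  | load f q ih => exact ih _ _
  | branch f q₁ q₂ ih₁ ih₂ =>
    simp only [TM2.stepAux, pushes]
    cases f v
    · have := ih₂ v S
      simp only [cond_false]
      omega
    · have := ih₁ v S
      simp only [cond_true]
      omega
  | goto f => exact le_rfl
  | halt => exact le_rfl

/-- A step executes one of finitely many statements, so the sum of their push counts bounds the
growth per step. Hence the output of a polynomial-time machine, which is the input of the program
run after it, has polynomial length. -/
theorem exists_length_le (tm : FinTM2) : ∃ c : ℕ, ∀ (n : ℕ) (a b : tm.Cfg) (k : tm.K),
    ReachesIn tm.step n a b → (b.stk k).length ≤ (a.stk k).length + n * c := by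
  have := tm.ΛFin
  refine ⟨∑ l, pushes (tm.m l), fun n => ?_⟩
  induction n with
  | zero =>
    intro a b k h
    have h' : some a = some b := h
    simp [Option.some.inj h']
  | succ n ih =>
    intro a b k h
    obtain ⟨c, hc, h⟩ := reachesIn_succ.1 h
    refine (ih c b k h).trans ?_
    obtain ⟨_ | l, v, S⟩ := a
    · cases hc
    · obtain rfl := Option.some.inj hc
      have h₁ := length_stepAux_le (tm.m l) v S k
      have h₂ : pushes (tm.m l) ≤ ∑ l, pushes (tm.m l) :=
        Finset.single_le_sum (f := fun l => pushes (tm.m l)) (fun _ _ => Nat.zero_le _)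
          (Finset.mem_univ l)
      rw [add_mul, one_mul]
      change (List.length ((TM2.stepAux (tm.m l) v S).stk k)) + _ ≤ (S k).length + _
      omega

/-! ### Running a program after a machine -/

section Compose

/-- A statement of a machine, for a machine that has more stacks and a further register;
halting is replaced with a jump. -/
def liftStmt {A : Type} {K₁ κ : Type} {Γ₁ : K₁ → Type} {Λ₁ σ₁ Λ₂ : Type} (exit : Λ₂) :
    TM2.Stmt Γ₁ Λ₁ σ₁ → TM2.Stmt (Sum.elim Γ₁ fun _ : κ => A) (Λ₁ ⊕ Λ₂) (σ₁ × Option A)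
  | .push k f q => .push (Sum.inl k) (fun v => f v.1) (liftStmt exit q)
  | .peek k f q => .peek (Sum.inl k) (fun v o => (f v.1 o, v.2)) (liftStmt exit q)
  | .pop k f q => .pop (Sum.inl k) (fun v o => (f v.1 o, v.2)) (liftStmt exit q)
  | .load f q => .load (fun v => (f v.1, v.2)) (liftStmt exit q)
  | .branch f q₁ q₂ => .branch (fun v => f v.1) (liftStmt exit q₁) (liftStmt exit q₂)
  | .goto f => .goto fun v => Sum.inl (f v.1)
  | .halt => .goto fun _ => Sum.inr exit

/-- A configuration of a machine, as a configuration of the larger machine. -/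
def liftCfg {A : Type} {K₁ κ : Type} {Γ₁ : K₁ → Type} {Λ₁ σ₁ Λ₂ : Type} (exit : Λ₂) (o : Option A)
    (S₂ : κ → List A) (a : TM2.Cfg Γ₁ Λ₁ σ₁) :
    TM2.Cfg (Sum.elim Γ₁ fun _ : κ => A) (Λ₁ ⊕ Λ₂) (σ₁ × Option A) :=
  ⟨some (a.l.elim (Sum.inr exit) Sum.inl), (a.var, o), joinStk a.stk S₂⟩

theorem stepAux_liftStmt {A : Type} {K₁ κ : Type} [DecidableEq K₁] [DecidableEq κ] {Γ₁ : K₁ → Type}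
    {Λ₁ σ₁ Λ₂ : Type} (exit : Λ₂) (o : Option A) (S₂ : κ → List A) (q : TM2.Stmt Γ₁ Λ₁ σ₁)
    (v : σ₁) (S₁ : ∀ k, List (Γ₁ k)) :
    TM2.stepAux (liftStmt exit q) (v, o) (joinStk S₁ S₂) =
      liftCfg exit o S₂ (TM2.stepAux q v S₁) := by
  induction q generalizing v S₁ with
  | push k f q ih => exact (congrArg _ (update_joinStk_inl ..)).trans (ih _ _)
  | peek k f q ih => exact ih _ _
  | pop k f q ih => exact (congrArg _ (update_joinStk_inl ..)).trans (ih _ _)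
  | load f q ih => exact ih _ _
  | branch f q₁ q₂ ih₁ ih₂ =>
    simp only [TM2.stepAux, liftStmt]
    cases f v
    · exact ih₂ _ _
    · exact ih₁ _ _
  | goto f => rfl
  | halt => rfl

variable {A : Type} [Inhabited A] {κ : Type} [DecidableEq κ] [Fintype κ] [Fintype A]

/-- The machine that runs `tm`, moves its output to the stack `kin` of the program `p` (which
reverses it), and runs `p`. -/
noncomputable def composeTM (tm : FinTM2) (φ : tm.Γ tm.k₁ → A) (p : Prog κ A) (kin kout : κ) :
    FinTM2 :=
  have := tm.kFin
  have := tm.ΛFin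
  have := tm.σFin
  have := finite_lab p
  { K := tm.K ⊕ κ
    k₀ := Sum.inl tm.k₀
    k₁ := Sum.inr kout
    Γ := Sum.elim tm.Γ fun _ => A
    Λ := tm.Λ ⊕ (Bool ⊕ p.Lab)
    main := Sum.inl tm.main
    ΛFin := Fintype.ofFinite _
    σ := tm.σ × Option A
    initialState := (tm.initialState, none)
    Γk₀Fin := tm.Γk₀Fin
    m := fun l => match l with
      | Sum.inl l => liftStmt (Sum.inl true) (tm.m l)
      | Sum.inr (Sum.inl true) => .pop (Sum.inl tm.k₁) (fun v o => (v.1, o.map φ))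
          (.branch (fun v => v.2.isSome)
            (.push (Sum.inr kin) (fun v => v.2.getD default)
              (.goto fun _ => Sum.inr (Sum.inl true)))
            (.goto fun _ => Sum.inr (Sum.inr p.entry)))
      -- A halting configuration must carry the initial register, so the scratch register is reset
      -- before halting.
      | Sum.inr (Sum.inl false) => .load (fun v => (v.1, none)) .halt
      | Sum.inr (Sum.inr l) =>
          p.code (fun l => Sum.inr (Sum.inr l)) (Sum.inr (Sum.inl false)) l }

/-- The stacks that are empty except for one. -/
def onlyStk {K : Type} [DecidableEq K] {Γ : K → Type} (k : K) (s : List (Γ k)) :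
    ∀ k, List (Γ k) :=
  update (fun _ => []) k s

theorem joinStk_onlyStk_left {A κ : Type} [DecidableEq κ] {K₁ : Type} [DecidableEq K₁] {Γ₁ : K₁ → Type} (k : K₁)
    (s : List (Γ₁ k)) :
    joinStk (onlyStk k s) (fun _ : κ => ([] : List A)) = onlyStk (Sum.inl k) s := by
  unfold onlyStk
  rw [← update_joinStk_inl]
  congr 1
  funext j
  cases j <;> rfl

theorem joinStk_onlyStk_right {A κ : Type} [DecidableEq κ] {K₁ : Type} [DecidableEq K₁] {Γ₁ : K₁ → Type} (k : κ)
    (s : List A) :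
    joinStk (Γ₁ := Γ₁) (fun _ => []) (onlyStk k s) = onlyStk (Sum.inr k) s := by
  unfold onlyStk
  rw [← update_joinStk_inr]
  congr 1
  funext j
  cases j <;> rfl

theorem initList_eq (tm : FinTM2) (s : List (tm.Γ tm.k₀)) :
    initList tm s = ⟨some tm.main, tm.initialState, onlyStk tm.k₀ s⟩ := by
  unfold initList onlyStk
  congr 1
  funext k
  by_cases h : k = tm.k₀
  · subst h
    simp
  · rw [update_of_ne h, dif_neg h]

theorem haltList_eq (tm : FinTM2) (s : List (tm.Γ tm.k₁)) :
    haltList tm s = ⟨none, tm.initialState, onlyStk tm.k₁ s⟩ := by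
  unfold haltList onlyStk
  congr 1
  funext k
  by_cases h : k = tm.k₁
  · subst h
    simp
  · rw [update_of_ne h, dif_neg h]

variable (tm : FinTM2) (φ : tm.Γ tm.k₁ → A) (p : Prog κ A) (kin kout : κ)

/-- The machine is simulated step by step. Since halting became a jump to `Sum.inl true`, its halted
configuration lifts to the start of the transfer phase. -/
theorem reachesIn_composeTM_lift {n : ℕ} {a b : tm.Cfg} (h : ReachesIn tm.step n a b) :
    ReachesIn (composeTM tm φ p kin kout).step n
      (liftCfg (Sum.inl true) none (fun _ => []) a)
      (liftCfg (Sum.inl true) none (fun _ => []) b) := by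
  induction n generalizing a with
  | zero =>
    obtain rfl : a = b := Option.some.inj h
    rfl
  | succ n ih =>
    obtain ⟨c, hc, h⟩ := reachesIn_succ.1 h
    refine reachesIn_succ.2 ⟨_, ?_, ih h⟩
    obtain ⟨_ | l, v, S⟩ := a
    · cases hc
    · obtain rfl := Option.some.inj hc
      exact congrArg some (stepAux_liftStmt ..)

theorem step_composeTM_move_nil (v : tm.σ) (o : Option A) (S₁ : ∀ k, List (tm.Γ k))
    (S₂ : κ → List A) (h : S₁ tm.k₁ = []) :
    (composeTM tm φ p kin kout).step
      ⟨some (Sum.inr (Sum.inl true)), (v, o), joinStk S₁ S₂⟩ =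
    some ⟨some (Sum.inr (Sum.inr p.entry)), (v, none), joinStk S₁ S₂⟩ := by
  have key : ∀ x : List (tm.Γ tm.k₁), x = [] →
      some (cond (x.head?.map φ).isSome
        (⟨some (Sum.inr (Sum.inl true)), (v, x.head?.map φ), update
          (update (joinStk S₁ S₂) (Sum.inl tm.k₁) x.tail) (Sum.inr kin)
          ((x.head?.map φ).getD default ::
            (update (joinStk S₁ S₂) (Sum.inl tm.k₁) x.tail (Sum.inr kin)))⟩ :
          (composeTM tm φ p kin kout).Cfg)
        ⟨some (Sum.inr (Sum.inr p.entry)), (v, x.head?.map φ),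
          update (joinStk S₁ S₂) (Sum.inl tm.k₁) x.tail⟩) =
      some ⟨some (Sum.inr (Sum.inr p.entry)), (v, none),
        update (joinStk S₁ S₂) (Sum.inl tm.k₁) []⟩ := by
    rintro _ rfl
    rfl
  have hS : update (joinStk S₁ S₂) (Sum.inl tm.k₁) [] = joinStk S₁ S₂ :=
    (update_joinStk_inl S₁ S₂ tm.k₁ []).trans
      (congrArg (joinStk · S₂) (by rw [← h, update_eq_self]))
  exact (key _ h).trans (congrArg (fun T => some (⟨some (Sum.inr (Sum.inr p.entry)), (v, none), T⟩ :
    (composeTM tm φ p kin kout).Cfg)) hS)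

theorem step_composeTM_move_cons (v : tm.σ) (o : Option A) (S₁ : ∀ k, List (tm.Γ k))
    (S₂ : κ → List A) (a : tm.Γ tm.k₁) (s : List (tm.Γ tm.k₁)) (h : S₁ tm.k₁ = a :: s) :
    (composeTM tm φ p kin kout).step
      ⟨some (Sum.inr (Sum.inl true)), (v, o), joinStk S₁ S₂⟩ =
    some ⟨some (Sum.inr (Sum.inl true)), (v, some (φ a)),
      joinStk (update S₁ tm.k₁ s) (update S₂ kin (φ a :: S₂ kin))⟩ := by
  have key : ∀ x : List (tm.Γ tm.k₁), x = a :: s →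
      some (cond (x.head?.map φ).isSome
        (⟨some (Sum.inr (Sum.inl true)), (v, x.head?.map φ), update
          (update (joinStk S₁ S₂) (Sum.inl tm.k₁) x.tail) (Sum.inr kin)
          ((x.head?.map φ).getD default ::
            (update (joinStk S₁ S₂) (Sum.inl tm.k₁) x.tail (Sum.inr kin)))⟩ :
          (composeTM tm φ p kin kout).Cfg)
        ⟨some (Sum.inr (Sum.inr p.entry)), (v, x.head?.map φ),
          update (joinStk S₁ S₂) (Sum.inl tm.k₁) x.tail⟩) =
      some ⟨some (Sum.inr (Sum.inl true)), (v, some (φ a)),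
        update (update (joinStk S₁ S₂) (Sum.inl tm.k₁) s) (Sum.inr kin)
          (φ a :: (update (joinStk S₁ S₂) (Sum.inl tm.k₁) s (Sum.inr kin)))⟩ := by
    rintro _ rfl
    rfl
  have hS : update (update (joinStk S₁ S₂) (Sum.inl tm.k₁) s) (Sum.inr kin)
      (φ a :: (update (joinStk S₁ S₂) (Sum.inl tm.k₁) s (Sum.inr kin))) =
      joinStk (update S₁ tm.k₁ s) (update S₂ kin (φ a :: S₂ kin)) := by
    rw [update_joinStk_inl]
    exact update_joinStk_inr (update S₁ tm.k₁ s) S₂ kin (φ a :: S₂ kin)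
  exact (key _ h).trans (congrArg (fun T => some (⟨some (Sum.inr (Sum.inl true)),
    (v, some (φ a)), T⟩ : (composeTM tm φ p kin kout).Cfg)) hS)

/-- Popping from one stack and pushing to the other reverses the word; the extra step is the one
that finds the stack empty and enters the program. -/
theorem reachesIn_composeTM_move (s : List (tm.Γ tm.k₁)) (v : tm.σ) (o : Option A)
    (S₁ : ∀ k, List (tm.Γ k)) (S₂ : κ → List A) (h : S₁ tm.k₁ = s) :
    ReachesIn (composeTM tm φ p kin kout).step (s.length + 1)
      ⟨some (Sum.inr (Sum.inl true)), (v, o), joinStk S₁ S₂⟩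
      ⟨some (Sum.inr (Sum.inr p.entry)), (v, none), joinStk (update S₁ tm.k₁ [])
        (update S₂ kin ((s.map φ).reverse ++ S₂ kin))⟩ := by
  induction s generalizing o S₁ S₂ with
  | nil =>
    refine ReachesIn.single ((step_composeTM_move_nil tm φ p kin kout v o S₁ S₂ h).trans ?_)
    rw [← h]
    simp only [List.map_nil, List.reverse_nil, List.nil_append, h]
    rw [update_eq_self kin S₂, ← h, update_eq_self]
  | cons a s ih =>
    have := ih (some (φ a)) (update S₁ tm.k₁ s) (update S₂ kin (φ a :: S₂ kin)) (update_self ..)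
    rw [update_idem, update_idem, update_self] at this
    refine reachesIn_succ.2 ⟨_, step_composeTM_move_cons tm φ p kin kout v o S₁ S₂ a s h, ?_⟩
    simpa using this

theorem runs_reachesIn_composeTM {S S' : κ → List A} {t : ℕ} (h : Runs p S S' t) (v : tm.σ)
    (o : Option A) (S₁ : ∀ k, List (tm.Γ k)) : ∃ n ≤ t + 1,
      ReachesIn (composeTM tm φ p kin kout).step n
        ⟨some (Sum.inr (Sum.inr p.entry)), (v, o), joinStk S₁ S⟩
        ⟨none, (v, none), joinStk S₁ S'⟩ := by
  obtain ⟨o', n, hn, h⟩ := h.reachesIn (composeTM tm φ p kin kout).m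
    (fun l => Sum.inr (Sum.inr l)) (Sum.inr (Sum.inl false)) (fun l => rfl) v o S₁
  exact ⟨n + 1, by omega, h.trans (ReachesIn.single rfl)⟩

/-- Post-processing the output of a polynomial-time machine with a polynomial-time program. The
program finds its input in reverse. -/
theorem polyTime_comp {α β γ αΓ : Type} {ea : α → List αΓ} {eb : β → List A} {ec : γ → List A}
    {f : α → β} {g : β → γ} (hf : TM2ComputableInPolyTime ea eb f) (p : Prog κ A) (kin kout : κ)
    (τ : Polynomial ℕ)
    (hg : ∀ b, Runs p (onlyStk kin (eb b).reverse) (onlyStk kout (ec (g b)))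
      (τ.eval (eb b).length)) :
    Nonempty (TM2ComputableInPolyTime ea ec (g ∘ f)) := by
  obtain ⟨c, hc⟩ := exists_length_le hf.tm
  have h_mono : Monotone fun n => τ.eval n := fun m n h => by
    simp only [Polynomial.eval_eq_sum, Polynomial.sum]
    gcongr
  -- The length of the intermediate output: at most the input length plus `c` symbols per step. It
  -- bounds the transfer and, through `τ`, the program.
  set B : Polynomial ℕ := Polynomial.X + hf.time * Polynomial.C c with hB
  have hex : ∀ a, ∃ n ≤ (hf.time + (B + 1) + (τ.comp B + 1)).eval (ea a).length,
      ReachesIn (composeTM hf.tm hf.outputAlphabet p kin kout).step n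
        (initList (composeTM hf.tm hf.outputAlphabet p kin kout)
          ((ea a).map hf.inputAlphabet.invFun))
        (haltList (composeTM hf.tm hf.outputAlphabet p kin kout) (ec (g (f a)))) := by
    intro a
    obtain ⟨⟨n, hn⟩, hle⟩ := hf.outputsFun a
    have h₁ : ReachesIn hf.tm.step n (initList hf.tm ((ea a).map hf.inputAlphabet.invFun))
      (haltList hf.tm ((eb (f a)).map hf.outputAlphabet.invFun)) := hn
    have h_len := hc _ _ _ hf.tm.k₁ h₁
    rw [initList_eq, haltList_eq] at h₁ h_len
    simp only [onlyStk, update_self, List.length_map] at h_len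
    have h_len' : (eb (f a)).length ≤ B.eval (ea a).length := by
      refine h_len.trans ?_
      simp only [hB, Polynomial.eval_add, Polynomial.eval_X, Polynomial.eval_mul,
        Polynomial.eval_C]
      refine add_le_add ?_ (Nat.mul_le_mul_right _ hle)
      -- The machine may use a single stack for input and output; its output stack then initially
      -- holds the input rather than nothing.
      by_cases h : hf.tm.k₁ = hf.tm.k₀
      · rw [← List.length_map (f := hf.inputAlphabet.invFun)]
        generalize (ea a).map hf.inputAlphabet.invFun = s
        revert s
        rw [← h]
        intro s
        rw [update_self]
      · rw [update_of_ne h]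
        exact Nat.zero_le _
    have h₂ := reachesIn_composeTM_lift hf.tm hf.outputAlphabet p kin kout h₁
    have h₃ := reachesIn_composeTM_move hf.tm hf.outputAlphabet p kin kout
      ((eb (f a)).map hf.outputAlphabet.invFun) hf.tm.initialState none
      (onlyStk hf.tm.k₁ ((eb (f a)).map hf.outputAlphabet.invFun)) (fun _ => []) (update_self ..)
    have h_map : (((eb (f a)).map hf.outputAlphabet.invFun).map hf.outputAlphabet).reverse ++ [] =
        (eb (f a)).reverse := by
      simp
    have h_nil : update (onlyStk hf.tm.k₁ ((eb (f a)).map hf.outputAlphabet.invFun)) hf.tm.k₁ [] =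
        fun _ => [] := by
      rw [onlyStk, update_idem]
      exact update_eq_self hf.tm.k₁ (fun _ => [])
    rw [h_map, h_nil] at h₃
    obtain ⟨m, hm, h₄⟩ := runs_reachesIn_composeTM hf.tm hf.outputAlphabet p kin kout (hg (f a))
      hf.tm.initialState none (fun _ => [])
    have h_init : initList (composeTM hf.tm hf.outputAlphabet p kin kout)
        ((ea a).map hf.inputAlphabet.invFun) =
        liftCfg (Sum.inl true) none (fun _ => []) ⟨some hf.tm.main, hf.tm.initialState,
          onlyStk hf.tm.k₀ ((ea a).map hf.inputAlphabet.invFun)⟩ :=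
      (initList_eq _ _).trans (congrArg (fun T => (⟨some (Sum.inl hf.tm.main),
        (hf.tm.initialState, none), T⟩ : (composeTM hf.tm hf.outputAlphabet p kin kout).Cfg))
          (joinStk_onlyStk_left _ _).symm)
    have h_halt : haltList (composeTM hf.tm hf.outputAlphabet p kin kout) (ec (g (f a))) =
        ⟨none, (hf.tm.initialState, none), joinStk (fun _ => []) (onlyStk kout (ec (g (f a))))⟩ :=
      (haltList_eq _ _).trans (congrArg (fun T => (⟨none,
        (hf.tm.initialState, none), T⟩ : (composeTM hf.tm hf.outputAlphabet p kin kout).Cfg))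
          (joinStk_onlyStk_right _ _).symm)
    rw [h_init, h_halt]
    refine ⟨_, ?_, (h₂.trans h₃).trans h₄⟩
    have := h_mono h_len'
    simp only [Polynomial.eval_add, Polynomial.eval_one, Polynomial.eval_comp,
      List.length_map] at this ⊢
    exact add_le_add (add_le_add hle (Nat.add_le_add_right h_len' 1))
      (hm.trans (Nat.add_le_add_right this 1))
  choose n hn h using hex
  refine ⟨⟨⟨composeTM hf.tm hf.outputAlphabet p kin kout, hf.inputAlphabet, Equiv.refl A⟩,
    hf.time + (B + 1) + (τ.comp B + 1), fun a => ⟨⟨n a, ?_⟩, hn a⟩⟩⟩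
  have h_id : (ec (g (f a))).map (Equiv.refl A).invFun = ec (g (f a)) := List.map_id _
  exact Eq.trans (h a) (congrArg (fun l =>
    some (haltList (composeTM hf.tm hf.outputAlphabet p kin kout) l)) h_id.symm)

end Compose

end Prog

end StackProg

/-! ### The program that amplifies a circuit -/

namespace MerlinQC

open StackProg StackProg.Prog Function

instance : Inhabited Sym := ⟨Sym.tick⟩

instance : Fintype Sym where
  elems := ⟨([.tick, .sep, .symH, .symT, .symX, .symC, .symF] : List Sym), by simp⟩
  complete a := by cases a <;> simp

/-- The stacks of the amplifying program. -/
inductive Reg : Type where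
  -- `I` holds the gates and `D` their reversal; `W`, `M` the register sizes in unary, `E` a backup
  -- of `M`; `J` the current data qubit, `T` the current partner or chain qubit, `Q` the rounds
  -- left; `R` the output so far, reversed; `P` is scratch for copying, `F` holds the arguments of
  -- the gate being inverted, `O` the final output.
  | I | D | W | M | E | J | Q | T | R | P | F | O
  deriving DecidableEq

instance : Fintype Reg where
  elems := ⟨([.I, .D, .W, .M, .E, .J, .Q, .T, .R, .P, .F, .O] : List Reg), by simp⟩
  complete a := by cases a <;> simp

/-- The contents of all stacks. -/
def st (i d w m e j q t r p f o : List Sym) : Reg → List Sym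
  | .I => i
  | .D => d
  | .W => w
  | .M => m
  | .E => e
  | .J => j
  | .Q => q
  | .T => t
  | .R => r
  | .P => p
  | .F => f
  | .O => o

/-! ### Elementary steps on each stack -/

section Stacks

variable {i d w m e j q t r p f o : List Sym}

@[simp] theorem update_st_I (x : List Sym) :
    update (st i d w m e j q t r p f o) .I x = st x d w m e j q t r p f o := by
  funext k; cases k <;> simp [st]

@[simp] theorem update_st_D (x : List Sym) :
    update (st i d w m e j q t r p f o) .D x = st i x w m e j q t r p f o := by
  funext k; cases k <;> simp [st]

@[simp] theorem update_st_W (x : List Sym) :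
    update (st i d w m e j q t r p f o) .W x = st i d x m e j q t r p f o := by
  funext k; cases k <;> simp [st]

@[simp] theorem update_st_M (x : List Sym) :
    update (st i d w m e j q t r p f o) .M x = st i d w x e j q t r p f o := by
  funext k; cases k <;> simp [st]

@[simp] theorem update_st_E (x : List Sym) :
    update (st i d w m e j q t r p f o) .E x = st i d w m x j q t r p f o := by
  funext k; cases k <;> simp [st]

@[simp] theorem update_st_J (x : List Sym) :
    update (st i d w m e j q t r p f o) .J x = st i d w m e x q t r p f o := by
  funext k; cases k <;> simp [st]

@[simp] theorem update_st_Q (x : List Sym) :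
    update (st i d w m e j q t r p f o) .Q x = st i d w m e j x t r p f o := by
  funext k; cases k <;> simp [st]

@[simp] theorem update_st_T (x : List Sym) :
    update (st i d w m e j q t r p f o) .T x = st i d w m e j q x r p f o := by
  funext k; cases k <;> simp [st]

@[simp] theorem update_st_R (x : List Sym) :
    update (st i d w m e j q t r p f o) .R x = st i d w m e j q t x p f o := by
  funext k; cases k <;> simp [st]

@[simp] theorem update_st_P (x : List Sym) :
    update (st i d w m e j q t r p f o) .P x = st i d w m e j q t r x f o := by
  funext k; cases k <;> simp [st]

@[simp] theorem update_st_F (x : List Sym) :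
    update (st i d w m e j q t r p f o) .F x = st i d w m e j q t r p x o := by
  funext k; cases k <;> simp [st]

@[simp] theorem update_st_O (x : List Sym) :
    update (st i d w m e j q t r p f o) .O x = st i d w m e j q t r p f x := by
  funext k; cases k <;> simp [st]

theorem push_I (a : Sym) : Runs (.push .I a) (st i d w m e j q t r p f o) (st (a :: i) d w m e j q t r p f o) 1 := by
  simpa [st] using Runs.push Reg.I a (st i d w m e j q t r p f o)

theorem push_D (a : Sym) : Runs (.push .D a) (st i d w m e j q t r p f o) (st i (a :: d) w m e j q t r p f o) 1 := by
  simpa [st] using Runs.push Reg.D a (st i d w m e j q t r p f o)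

theorem push_W (a : Sym) : Runs (.push .W a) (st i d w m e j q t r p f o) (st i d (a :: w) m e j q t r p f o) 1 := by
  simpa [st] using Runs.push Reg.W a (st i d w m e j q t r p f o)

theorem push_M (a : Sym) : Runs (.push .M a) (st i d w m e j q t r p f o) (st i d w (a :: m) e j q t r p f o) 1 := by
  simpa [st] using Runs.push Reg.M a (st i d w m e j q t r p f o)

theorem push_E (a : Sym) : Runs (.push .E a) (st i d w m e j q t r p f o) (st i d w m (a :: e) j q t r p f o) 1 := by
  simpa [st] using Runs.push Reg.E a (st i d w m e j q t r p f o)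

theorem push_J (a : Sym) : Runs (.push .J a) (st i d w m e j q t r p f o) (st i d w m e (a :: j) q t r p f o) 1 := by
  simpa [st] using Runs.push Reg.J a (st i d w m e j q t r p f o)

theorem push_Q (a : Sym) : Runs (.push .Q a) (st i d w m e j q t r p f o) (st i d w m e j (a :: q) t r p f o) 1 := by
  simpa [st] using Runs.push Reg.Q a (st i d w m e j q t r p f o)

theorem push_T (a : Sym) : Runs (.push .T a) (st i d w m e j q t r p f o) (st i d w m e j q (a :: t) r p f o) 1 := by
  simpa [st] using Runs.push Reg.T a (st i d w m e j q t r p f o)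

theorem push_R (a : Sym) : Runs (.push .R a) (st i d w m e j q t r p f o) (st i d w m e j q t (a :: r) p f o) 1 := by
  simpa [st] using Runs.push Reg.R a (st i d w m e j q t r p f o)

theorem push_P (a : Sym) : Runs (.push .P a) (st i d w m e j q t r p f o) (st i d w m e j q t r (a :: p) f o) 1 := by
  simpa [st] using Runs.push Reg.P a (st i d w m e j q t r p f o)

theorem push_F (a : Sym) : Runs (.push .F a) (st i d w m e j q t r p f o) (st i d w m e j q t r p (a :: f) o) 1 := by
  simpa [st] using Runs.push Reg.F a (st i d w m e j q t r p f o)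

theorem push_O (a : Sym) : Runs (.push .O a) (st i d w m e j q t r p f o) (st i d w m e j q t r p f (a :: o)) 1 := by
  simpa [st] using Runs.push Reg.O a (st i d w m e j q t r p f o)

theorem loop_I_cons {c : Sym → Bool} {b : Sym → Prog Reg Sym} {a : Sym} {u v : ℕ}
    {S S' : Reg → List Sym} (hc : c a = true) (h : Runs (b a) (st i d w m e j q t r p f o) S u)
    (h' : Runs (.loop .I c b) S S' v) :
    Runs (.loop .I c b) (st (a :: i) d w m e j q t r p f o) S' (u + v + 1) :=
  Runs.loop_step (l := i) rfl hc (by simpa using h) h'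

theorem loop_I_nil {c : Sym → Bool} {b : Sym → Prog Reg Sym} :
    Runs (.loop .I c b) (st [] d w m e j q t r p f o) (st [] d w m e j q t r p f o) 1 := by
  simpa [st] using Runs.loop_exit (k := Reg.I) (c := c) (body := b) (S := st [] d w m e j q t r p f o) rfl

theorem loop_D_cons {c : Sym → Bool} {b : Sym → Prog Reg Sym} {a : Sym} {u v : ℕ}
    {S S' : Reg → List Sym} (hc : c a = true) (h : Runs (b a) (st i d w m e j q t r p f o) S u)
    (h' : Runs (.loop .D c b) S S' v) :
    Runs (.loop .D c b) (st i (a :: d) w m e j q t r p f o) S' (u + v + 1) :=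
  Runs.loop_step (l := d) rfl hc (by simpa using h) h'

theorem loop_D_nil {c : Sym → Bool} {b : Sym → Prog Reg Sym} :
    Runs (.loop .D c b) (st i [] w m e j q t r p f o) (st i [] w m e j q t r p f o) 1 := by
  simpa [st] using Runs.loop_exit (k := Reg.D) (c := c) (body := b) (S := st i [] w m e j q t r p f o) rfl

theorem loop_W_cons {c : Sym → Bool} {b : Sym → Prog Reg Sym} {a : Sym} {u v : ℕ}
    {S S' : Reg → List Sym} (hc : c a = true) (h : Runs (b a) (st i d w m e j q t r p f o) S u)
    (h' : Runs (.loop .W c b) S S' v) :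
    Runs (.loop .W c b) (st i d (a :: w) m e j q t r p f o) S' (u + v + 1) :=
  Runs.loop_step (l := w) rfl hc (by simpa using h) h'

theorem loop_W_nil {c : Sym → Bool} {b : Sym → Prog Reg Sym} :
    Runs (.loop .W c b) (st i d [] m e j q t r p f o) (st i d [] m e j q t r p f o) 1 := by
  simpa [st] using Runs.loop_exit (k := Reg.W) (c := c) (body := b) (S := st i d [] m e j q t r p f o) rfl

theorem loop_M_cons {c : Sym → Bool} {b : Sym → Prog Reg Sym} {a : Sym} {u v : ℕ}
    {S S' : Reg → List Sym} (hc : c a = true) (h : Runs (b a) (st i d w m e j q t r p f o) S u)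
    (h' : Runs (.loop .M c b) S S' v) :
    Runs (.loop .M c b) (st i d w (a :: m) e j q t r p f o) S' (u + v + 1) :=
  Runs.loop_step (l := m) rfl hc (by simpa using h) h'

theorem loop_M_nil {c : Sym → Bool} {b : Sym → Prog Reg Sym} :
    Runs (.loop .M c b) (st i d w [] e j q t r p f o) (st i d w [] e j q t r p f o) 1 := by
  simpa [st] using Runs.loop_exit (k := Reg.M) (c := c) (body := b) (S := st i d w [] e j q t r p f o) rfl

theorem loop_E_cons {c : Sym → Bool} {b : Sym → Prog Reg Sym} {a : Sym} {u v : ℕ}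
    {S S' : Reg → List Sym} (hc : c a = true) (h : Runs (b a) (st i d w m e j q t r p f o) S u)
    (h' : Runs (.loop .E c b) S S' v) :
    Runs (.loop .E c b) (st i d w m (a :: e) j q t r p f o) S' (u + v + 1) :=
  Runs.loop_step (l := e) rfl hc (by simpa using h) h'

theorem loop_E_nil {c : Sym → Bool} {b : Sym → Prog Reg Sym} :
    Runs (.loop .E c b) (st i d w m [] j q t r p f o) (st i d w m [] j q t r p f o) 1 := by
  simpa [st] using Runs.loop_exit (k := Reg.E) (c := c) (body := b) (S := st i d w m [] j q t r p f o) rfl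

theorem loop_J_cons {c : Sym → Bool} {b : Sym → Prog Reg Sym} {a : Sym} {u v : ℕ}
    {S S' : Reg → List Sym} (hc : c a = true) (h : Runs (b a) (st i d w m e j q t r p f o) S u)
    (h' : Runs (.loop .J c b) S S' v) :
    Runs (.loop .J c b) (st i d w m e (a :: j) q t r p f o) S' (u + v + 1) :=
  Runs.loop_step (l := j) rfl hc (by simpa using h) h'

theorem loop_J_nil {c : Sym → Bool} {b : Sym → Prog Reg Sym} :
    Runs (.loop .J c b) (st i d w m e [] q t r p f o) (st i d w m e [] q t r p f o) 1 := by
  simpa [st] using Runs.loop_exit (k := Reg.J) (c := c) (body := b) (S := st i d w m e [] q t r p f o) rfl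

theorem loop_Q_cons {c : Sym → Bool} {b : Sym → Prog Reg Sym} {a : Sym} {u v : ℕ}
    {S S' : Reg → List Sym} (hc : c a = true) (h : Runs (b a) (st i d w m e j q t r p f o) S u)
    (h' : Runs (.loop .Q c b) S S' v) :
    Runs (.loop .Q c b) (st i d w m e j (a :: q) t r p f o) S' (u + v + 1) :=
  Runs.loop_step (l := q) rfl hc (by simpa using h) h'

theorem loop_Q_nil {c : Sym → Bool} {b : Sym → Prog Reg Sym} :
    Runs (.loop .Q c b) (st i d w m e j [] t r p f o) (st i d w m e j [] t r p f o) 1 := by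
  simpa [st] using Runs.loop_exit (k := Reg.Q) (c := c) (body := b) (S := st i d w m e j [] t r p f o) rfl

theorem loop_T_cons {c : Sym → Bool} {b : Sym → Prog Reg Sym} {a : Sym} {u v : ℕ}
    {S S' : Reg → List Sym} (hc : c a = true) (h : Runs (b a) (st i d w m e j q t r p f o) S u)
    (h' : Runs (.loop .T c b) S S' v) :
    Runs (.loop .T c b) (st i d w m e j q (a :: t) r p f o) S' (u + v + 1) :=
  Runs.loop_step (l := t) rfl hc (by simpa using h) h'

theorem loop_T_nil {c : Sym → Bool} {b : Sym → Prog Reg Sym} :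
    Runs (.loop .T c b) (st i d w m e j q [] r p f o) (st i d w m e j q [] r p f o) 1 := by
  simpa [st] using Runs.loop_exit (k := Reg.T) (c := c) (body := b) (S := st i d w m e j q [] r p f o) rfl

theorem loop_R_cons {c : Sym → Bool} {b : Sym → Prog Reg Sym} {a : Sym} {u v : ℕ}
    {S S' : Reg → List Sym} (hc : c a = true) (h : Runs (b a) (st i d w m e j q t r p f o) S u)
    (h' : Runs (.loop .R c b) S S' v) :
    Runs (.loop .R c b) (st i d w m e j q t (a :: r) p f o) S' (u + v + 1) :=
  Runs.loop_step (l := r) rfl hc (by simpa using h) h'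

theorem loop_R_nil {c : Sym → Bool} {b : Sym → Prog Reg Sym} :
    Runs (.loop .R c b) (st i d w m e j q t [] p f o) (st i d w m e j q t [] p f o) 1 := by
  simpa [st] using Runs.loop_exit (k := Reg.R) (c := c) (body := b) (S := st i d w m e j q t [] p f o) rfl

theorem loop_P_cons {c : Sym → Bool} {b : Sym → Prog Reg Sym} {a : Sym} {u v : ℕ}
    {S S' : Reg → List Sym} (hc : c a = true) (h : Runs (b a) (st i d w m e j q t r p f o) S u)
    (h' : Runs (.loop .P c b) S S' v) :
    Runs (.loop .P c b) (st i d w m e j q t r (a :: p) f o) S' (u + v + 1) :=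
  Runs.loop_step (l := p) rfl hc (by simpa using h) h'

theorem loop_P_nil {c : Sym → Bool} {b : Sym → Prog Reg Sym} :
    Runs (.loop .P c b) (st i d w m e j q t r [] f o) (st i d w m e j q t r [] f o) 1 := by
  simpa [st] using Runs.loop_exit (k := Reg.P) (c := c) (body := b) (S := st i d w m e j q t r [] f o) rfl

theorem loop_F_cons {c : Sym → Bool} {b : Sym → Prog Reg Sym} {a : Sym} {u v : ℕ}
    {S S' : Reg → List Sym} (hc : c a = true) (h : Runs (b a) (st i d w m e j q t r p f o) S u)
    (h' : Runs (.loop .F c b) S S' v) :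
    Runs (.loop .F c b) (st i d w m e j q t r p (a :: f) o) S' (u + v + 1) :=
  Runs.loop_step (l := f) rfl hc (by simpa using h) h'

theorem loop_F_nil {c : Sym → Bool} {b : Sym → Prog Reg Sym} :
    Runs (.loop .F c b) (st i d w m e j q t r p [] o) (st i d w m e j q t r p [] o) 1 := by
  simpa [st] using Runs.loop_exit (k := Reg.F) (c := c) (body := b) (S := st i d w m e j q t r p [] o) rfl

theorem loop_I_exit {c : Sym → Bool} {b : Sym → Prog Reg Sym} {a : Sym} (hc : c a = false) :
    Runs (.loop .I c b) (st (a :: i) d w m e j q t r p f o) (st i d w m e j q t r p f o) 1 := by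
  simpa [st] using Runs.loop_exit (k := Reg.I) (c := c) (body := b)
    (S := st (a :: i) d w m e j q t r p f o) (by simpa [st] using hc)

theorem loop_J_exit {c : Sym → Bool} {b : Sym → Prog Reg Sym} {a : Sym} (hc : c a = false) :
    Runs (.loop .J c b) (st i d w m e (a :: j) q t r p f o) (st i d w m e j q t r p f o) 1 := by
  simpa [st] using Runs.loop_exit (k := Reg.J) (c := c) (body := b)
    (S := st i d w m e (a :: j) q t r p f o) (by simpa [st] using hc)

end Stacks

theorem runs_of_eq {p : Prog Reg Sym} {S S' T T' : Reg → List Sym} {t t' : ℕ} (h : Runs p S S' t)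
    (hS : S = T) (hS' : S' = T') (ht : t ≤ t') : Runs p T T' t' := by
  subst hS hS'
  exact h.mono ht

/-- A number as a stack of ticks. -/
abbrev ticks (n : ℕ) : List Sym := List.replicate n Sym.tick

theorem ticks_append_cons (a : ℕ) (l : List Sym) : ticks a ++ Sym.tick :: l = ticks (a + 1) ++ l := by
  simp [ticks, List.replicate_succ']

def isTick : Sym → Bool
  | .tick => true
  | _ => false

/-- The symbols that occur in the arguments of a gate. -/
def isArg : Sym → Bool
  | .tick => true
  | .sep => true
  | _ => false

def always : Sym → Bool := fun _ => true

/-- The descriptions of gates with arbitrary arguments. -/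
abbrev strH (i : ℕ) : List Sym := .symH :: encodeNat i
abbrev strX (i : ℕ) : List Sym := .symX :: encodeNat i
abbrev strC (c t : ℕ) : List Sym := .symC :: (encodeNat c ++ encodeNat t)
abbrev strF (a b t : ℕ) : List Sym := .symF :: (encodeNat a ++ encodeNat b ++ encodeNat t)

/-- Write the number on the stack `k` to the output. -/
def emit (k : Reg) : Prog Reg Sym :=
  .seq (.loop k always fun a => .seq (.push .R a) (.push .P a))
    (.seq (.loop .P always fun a => .push k a) (.push .R .sep))

def emitX : Prog Reg Sym := .seq (.push .R .symX) (emit .J)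

/-- Write a Toffoli gate whose controls are the qubit on the stack `T` and the qubit written by
`arg`, and whose target is the next qubit; increment `T`. -/
def check (arg : Prog Reg Sym) : Prog Reg Sym :=
  .seq (.push .R .symF) (.seq (emit .T) (.seq arg (.seq (.push .T .tick) (emit .T))))

section Programs

variable {i d w m e j q t r p f o : List Sym}

/-- Popping destroys the number, so each symbol goes to both `R` and `P`, and `P` is then poured
back. The two passes cost 3 and 2 steps per tick. -/
theorem runs_emit_T {n : ℕ} : Runs (emit .T) (st i d w m e j q (ticks n) r [] f o)
    (st i d w m e j q (ticks n) ((encodeNat n).reverse ++ r) [] f o) (5 * n + 3) := by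
  have h₁ : ∀ l r p, Runs (.loop .T always fun a => .seq (.push .R a) (.push .P a))
      (st i d w m e j q l r p f o)
      (st i d w m e j q [] (l.reverse ++ r) (l.reverse ++ p) f o) (3 * l.length + 1) := by
    intro l
    induction l with
    | nil => exact fun r p => loop_T_nil
    | cons a l ih =>
      intro r p
      exact runs_of_eq (loop_T_cons rfl (push_R a |>.seq <| push_P a) (ih _ _)) rfl (by simp)
        (by simp; omega)
  have h₂ : ∀ l t, Runs (.loop .P always fun a => .push .T a)
      (st i d w m e j q t (ticks n ++ r) l f o)
      (st i d w m e j q (l.reverse ++ t) (ticks n ++ r) [] f o) (2 * l.length + 1) := by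
    intro l
    induction l with
    | nil => exact fun t => loop_P_nil
    | cons a l ih =>
      intro t
      exact runs_of_eq (loop_P_cons rfl (push_T a) (ih _)) rfl (by simp) (by simp; omega)
  have h := h₁ (ticks n) r []
  simp only [ticks, List.reverse_replicate, List.append_nil, List.length_replicate] at h
  exact runs_of_eq (h.seq ((h₂ (ticks n) []).seq (push_R .sep))) rfl
    (by simp [encodeNat]) (by simp; omega)

theorem runs_emit_J {n : ℕ} : Runs (emit .J) (st i d w m e (ticks n) q t r [] f o)
    (st i d w m e (ticks n) q t ((encodeNat n).reverse ++ r) [] f o) (5 * n + 3) := by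
  have h₁ : ∀ l r p, Runs (.loop .J always fun a => .seq (.push .R a) (.push .P a))
      (st i d w m e l q t r p f o)
      (st i d w m e [] q t (l.reverse ++ r) (l.reverse ++ p) f o) (3 * l.length + 1) := by
    intro l
    induction l with
    | nil => exact fun r p => loop_J_nil
    | cons a l ih =>
      intro r p
      exact runs_of_eq (loop_J_cons rfl (push_R a |>.seq <| push_P a) (ih _ _)) rfl (by simp)
        (by simp; omega)
  have h₂ : ∀ l j, Runs (.loop .P always fun a => .push .J a)
      (st i d w m e j q t (ticks n ++ r) l f o)
      (st i d w m e (l.reverse ++ j) q t (ticks n ++ r) [] f o) (2 * l.length + 1) := by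
    intro l
    induction l with
    | nil => exact fun t => loop_P_nil
    | cons a l ih =>
      intro t
      exact runs_of_eq (loop_P_cons rfl (push_J a) (ih _)) rfl (by simp) (by simp; omega)
  have h := h₁ (ticks n) r []
  simp only [ticks, List.reverse_replicate, List.append_nil, List.length_replicate] at h
  exact runs_of_eq (h.seq ((h₂ (ticks n) []).seq (push_R .sep))) rfl
    (by simp [encodeNat]) (by simp; omega)

theorem runs_emitX {n : ℕ} : Runs emitX (st i d w m e (ticks n) q t r [] f o)
    (st i d w m e (ticks n) q t ((strX n).reverse ++ r) [] f o) (5 * n + 4) :=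
  runs_of_eq ((push_R .symX).seq runs_emit_J) rfl (by simp) (by omega)

theorem runs_check {arg : Prog Reg Sym} {n x u : ℕ}
    (h : ∀ r, Runs arg (st i d w m e j q (ticks n) r [] f o)
      (st i d w m e j q (ticks n) ((encodeNat x).reverse ++ r) [] f o) u) :
    Runs (check arg) (st i d w m e j q (ticks n) r [] f o)
      (st i d w m e j q (ticks (n + 1)) ((strF n x (n + 1)).reverse ++ r) [] f o)
      (10 * n + u + 13) :=
  runs_of_eq ((push_R .symF).seq (runs_emit_T.seq ((h _).seq
    ((push_T .tick).seq (runs_emit_T (n := n + 1)))))) rfl (by simp) (by omega)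

end Programs

/-- Postselection of `a` qubits from `x` on being `0`, with chain qubits from `t` on. -/
def ancillaStr : ℕ → ℕ → ℕ → List Sym
  | 0, _, _ => []
  | a + 1, x, t => strX x ++ strF t x (t + 1) ++ strX x ++ ancillaStr a (x + 1) (t + 1)

/-- Bell pairs of the `a` qubits from `x` on with the qubits from `t` on. -/
def bellStr : ℕ → ℕ → ℕ → List Sym
  | 0, _, _ => []
  | a + 1, x, t => strH x ++ strC x t ++ bellStr a (x + 1) (t + 1)

/-- The `X` gates around the Toffoli gate turn its test for `1` into a test for `0`. `E` counts the
ticks taken from `M`, so that they can be put back for the next round. -/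
def ancillaProg : Prog Reg Sym :=
  .loop .M always fun _ => .seq emitX (.seq (check (emit .J)) (.seq emitX
    (.seq (.push .J .tick) (.push .E .tick))))

/-- The inner loop, whose condition never holds, pops exactly one symbol: it decrements `J`. -/
def restoreProg : Prog Reg Sym :=
  .loop .E always fun _ => .seq (.push .M .tick) (.loop .J (fun _ => false) fun _ => .skip)

/-- Besides writing the gates, this moves `J` from 0 to the number of witness qubits, the position
of the first ancilla, which every round needs. -/
def bellProg : Prog Reg Sym :=
  .loop .W always fun _ => .seq (.push .R .symH) (.seq (emit .J) (.seq (.push .R .symC)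
    (.seq (emit .J) (.seq (emit .T) (.seq (.push .T .tick) (.push .J .tick))))))

section Programs

variable {i d w m e j q t r p f o : List Sym}

theorem runs_ancillaProg (a x n : ℕ) (e r : List Sym) :
    Runs ancillaProg (st i d w (ticks a) e (ticks x) q (ticks n) r [] f o)
      (st i d w [] (ticks a ++ e) (ticks (x + a)) q (ticks (n + a))
        ((ancillaStr a x n).reverse ++ r) [] f o) (a * (15 * (x + a) + 10 * (n + a) + 30) + 1) := by
  induction a generalizing x n e r with
  | zero => exact runs_of_eq loop_M_nil rfl rfl (by omega)
  | succ a ih =>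
    have h := ih (x + 1) (n + 1) (.tick :: e) ((strX x ++ strF n x (n + 1) ++ strX x).reverse ++ r)
    refine runs_of_eq (loop_M_cons (a := .tick) rfl (runs_emitX.seq ((runs_check (x := x)
      (fun r => runs_emit_J)).seq (runs_emitX.seq ((push_J .tick).seq (push_E .tick)))))
      (runs_of_eq h ?_ rfl le_rfl)) rfl ?_ ?_
    · simp [List.replicate_succ]
    · rw [ticks_append_cons, show x + 1 + a = x + (a + 1) by ring, show n + 1 + a = n + (a + 1) by ring]
      simp [ancillaStr]
    · ring_nf
      nlinarith

theorem runs_restoreProg (a x b : ℕ) :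
    Runs restoreProg (st i d w (ticks b) (ticks a) (ticks (x + a)) q t r p f o)
      (st i d w (ticks (b + a)) [] (ticks x) q t r p f o) (3 * a + 1) := by
  induction a generalizing b with
  | zero => exact loop_E_nil
  | succ a ih =>
    exact runs_of_eq (loop_E_cons (a := .tick) rfl ((push_M .tick).seq
      (loop_J_exit (a := .tick) (j := ticks (x + a)) rfl))
      (ih (b + 1))) rfl (by rw [show b + 1 + a = b + (a + 1) by ring]) (by omega)

theorem runs_ancillaProg_restoreProg (a x n : ℕ) (r : List Sym) :
    Runs (.seq ancillaProg restoreProg)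
      (st i d w (ticks a) [] (ticks x) q (ticks n) r [] f o)
      (st i d w (ticks a) [] (ticks x) q (ticks (n + a)) ((ancillaStr a x n).reverse ++ r) [] f o)
      (a * (15 * (x + a) + 10 * (n + a) + 30) + 1 + (3 * a + 1)) := by
  have h := runs_ancillaProg (i := i) (d := d) (w := w) (q := q) (f := f) (o := o) a x n [] r
  have h' := runs_restoreProg (i := i) (d := d) (w := w) (q := q) (t := ticks (n + a))
    (r := (ancillaStr a x n).reverse ++ r) (p := []) (f := f) (o := o) a x 0
  rw [List.append_nil] at h
  rw [Nat.zero_add] at h'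
  exact h.seq h'

theorem runs_bellProg (a x n : ℕ) (r : List Sym) :
    Runs bellProg (st i d (ticks a) m e (ticks x) q (ticks n) r [] f o)
      (st i d [] m e (ticks (x + a)) q (ticks (n + a))
        ((bellStr a x n).reverse ++ r) [] f o) (a * (10 * (x + a) + 5 * (n + a) + 14) + 1) := by
  induction a generalizing x n r with
  | zero => exact runs_of_eq loop_W_nil rfl rfl (by omega)
  | succ a ih =>
    have h := ih (x + 1) (n + 1) ((strH x ++ strC x n).reverse ++ r)
    refine runs_of_eq (loop_W_cons (a := .tick) rfl ((push_R .symH).seq (runs_emit_J.seq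
      ((push_R .symC).seq (runs_emit_J.seq (runs_emit_T.seq
      ((push_T .tick).seq (push_J .tick)))))))
      (runs_of_eq h ?_ rfl le_rfl)) rfl ?_ ?_
    · simp [List.replicate_succ]
    · rw [show x + 1 + a = x + (a + 1) by ring, show n + 1 + a = n + (a + 1) by ring]
      simp [bellStr]
    · ring_nf
      nlinarith

end Programs

/-- Run a program `n` times. -/
def rep : ℕ → Prog Reg Sym → Prog Reg Sym
  | 0, _ => .skip
  | n + 1, p => .seq p (rep n p)

/-- Write `a` and the contents of the stack `F` to the output. -/
def emitGate (a : Sym) : Prog Reg Sym :=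
  .seq (.push .R a) (.seq (.loop .F always fun b => .seq (.push .R b) (.push .P b))
    (.loop .P always fun b => .push .F b))

/-- Read the gates on the stack `D`, which are described in reverse, and write each of them seven
times. -/
def inverseProg : Prog Reg Sym :=
  .loop .D always fun a => .seq (.push .I a) (cond (isArg a) (.push .F a)
    (.seq (rep 7 (emitGate a)) (.loop .F always fun _ => .skip)))

/-- The gates of the inverse of a circuit; each gate `g` satisfies `g ^ 8 = 1`. -/
def inverseGates {N : ℕ} (gs : List (Gate N)) : List (Gate N) :=
  gs.reverse.flatMap fun g => List.replicate 7 g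

/-! ### Writing the inverse circuit -/

section Programs

variable {i d w m e j q t r p f o : List Sym}

theorem runs_emitGate (a : Sym) : Runs (emitGate a) (st i d w m e j q t r [] f o)
    (st i d w m e j q t ((a :: f).reverse ++ r) [] f o) (5 * f.length + 3) := by
  have h₁ : ∀ l r p, Runs (.loop .F always fun a => .seq (.push .R a) (.push .P a))
      (st i d w m e j q t r p l o)
      (st i d w m e j q t (l.reverse ++ r) (l.reverse ++ p) [] o) (3 * l.length + 1) := by
    intro l
    induction l with
    | nil => exact fun r p => loop_F_nil
    | cons a l ih =>
      intro r p
      exact runs_of_eq (loop_F_cons rfl (push_R a |>.seq <| push_P a) (ih _ _)) rfl (by simp)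
        (by simp; omega)
  have h₂ : ∀ l r f, Runs (.loop .P always fun a => .push .F a)
      (st i d w m e j q t r l f o)
      (st i d w m e j q t r [] (l.reverse ++ f) o) (2 * l.length + 1) := by
    intro l
    induction l with
    | nil => exact fun r f => loop_P_nil
    | cons a l ih =>
      intro r f
      exact runs_of_eq (loop_P_cons rfl (push_F a) (ih _ _)) rfl (by simp) (by simp; omega)
  exact runs_of_eq ((push_R a).seq ((h₁ _ _ _).seq (h₂ _ _ _))) rfl
    (by simp) (by simp; omega)

theorem runs_rep_emitGate (n : ℕ) (a : Sym) (r : List Sym) :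
    Runs (rep n (emitGate a)) (st i d w m e j q t r [] f o)
      (st i d w m e j q t ((List.replicate n (a :: f)).flatten.reverse ++ r) [] f o)
      (n * (5 * f.length + 3) + 1) := by
  induction n generalizing r with
  | zero => exact runs_of_eq (Runs.skip _) rfl (by simp) (by omega)
  | succ n ih =>
    exact runs_of_eq ((runs_emitGate a).seq (ih _)) rfl (by simp [List.replicate_succ])
      (by rw [add_mul]; omega)

theorem runs_clear_F (f : List Sym) : Runs (.loop .F always fun _ => .skip)
    (st i d w m e j q t r p f o) (st i d w m e j q t r p [] o) (2 * f.length + 1) := by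
  induction f with
  | nil => exact loop_F_nil
  | cons a f ih => exact runs_of_eq (loop_F_cons rfl (Runs.skip _) ih) rfl rfl (by simp; omega)

/-- Read backwards, the arguments of a gate precede its type symbol. Pushing them restores their
order on `F`, and on `I`, where the circuit is rebuilt for the next round. -/
theorem runs_inverseProg_args {S : Reg → List Sym} {u : ℕ} (l i f : List Sym)
    (hl : ∀ a ∈ l, isArg a = true)
    (h : Runs inverseProg (st (l.reverse ++ i) d w m e j q t r p (l.reverse ++ f) o) S u) :
    Runs inverseProg (st i (l ++ d) w m e j q t r p f o) S (u + 3 * l.length) := by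
  induction l generalizing i f with
  | nil => exact h
  | cons a l ih =>
    have ha : isArg a = true := hl a (by simp)
    refine runs_of_eq (loop_D_cons (d := l ++ d) rfl ((push_I a).seq (?_ : Runs _ _ _ 1))
      (ih (a :: i) (a :: f) (fun b hb => hl b (by simp [hb])) (by simpa using h))) rfl rfl
      (by simp; omega)
    rw [ha]
    exact push_F a

theorem isArg_of_mem_encodeNat {n : ℕ} {a : Sym} (h : a ∈ encodeNat n) : isArg a = true := by
  simp only [encodeNat, List.mem_append, List.mem_replicate, List.mem_singleton] at h
  rcases h with ⟨_, rfl⟩ | rfl <;> rfl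

/-- The type symbol is the only one that is not an argument symbol, so a backward reader knows when
a gate is complete. -/
theorem Gate.exists_encode_eq {N : ℕ} (g : Gate N) :
    ∃ a l, g.encode = a :: l ∧ isArg a = false ∧ ∀ b ∈ l, isArg b = true := by
  cases g
  all_goals
    refine ⟨_, _, rfl, rfl, fun b hb => ?_⟩
    try simp only [List.mem_append] at hb
    first
      | exact isArg_of_mem_encodeNat hb
      | rcases hb with hb | hb <;> exact isArg_of_mem_encodeNat hb
      | rcases hb with (hb | hb) | hb <;> exact isArg_of_mem_encodeNat hb

/-- The stack `D` delivers the last gate first, which is the order of the inverse circuit; hence the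
induction from the end of the list. A gate with `l` argument symbols costs `40 * l + 25` steps, at
most 40 per symbol. -/
theorem runs_inverseProg {N : ℕ} (gs : List (Gate N)) (i r : List Sym) :
    Runs inverseProg (st i (gs.flatMap Gate.encode).reverse w m e j q t r [] [] o)
      (st (gs.flatMap Gate.encode ++ i) [] w m e j q t
        (((inverseGates gs).flatMap Gate.encode).reverse ++ r) [] [] o)
      (40 * (gs.flatMap Gate.encode).length + 1) := by
  induction gs using List.reverseRecOn generalizing i r with
  | nil => exact loop_D_nil
  | append_singleton gs g ih =>
    obtain ⟨a, l, hg, ha, hl⟩ := g.exists_encode_eq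
    have h := ih (g.encode ++ i) ((List.replicate 7 g.encode).flatten.reverse ++ r)
    have h₁ : Runs inverseProg (st (l ++ i) (a :: (gs.flatMap Gate.encode).reverse)
        w m e j q t r [] l o) _ _ :=
      loop_D_cons (a := a) (u := 1 + ((7 * (5 * l.length + 3) + 1) + (2 * l.length + 1))) rfl
        ((push_I a).seq (by
          rw [ha]
          exact (runs_rep_emitGate 7 a r).seq (runs_clear_F l)))
        (runs_of_eq h (by rw [hg]; rfl) rfl le_rfl)
    have h₂ := runs_inverseProg_args l.reverse i [] (by simpa using hl) (by simpa using h₁)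
    refine runs_of_eq h₂ (by simp [hg]) ?_ ?_
    · simp [inverseGates, List.flatMap_def]
    · simp [hg]; omega

end Programs

/-- One round of the amplified circuit: the circuit, postselection of its first two qubits on being
`1`, the inverse circuit, and postselection of the `m` ancilla qubits on being `0`. -/
def roundStr (G G' : List Sym) (w m t : ℕ) : List Sym :=
  G ++ strF t 0 (t + 1) ++ strF (t + 1) 1 (t + 2) ++ G' ++ ancillaStr m w (t + 2)

def roundsStr (G G' : List Sym) (w m : ℕ) : ℕ → ℕ → List Sym
  | 0, _ => []
  | k + 1, t => roundStr G G' w m t ++ roundsStr G G' w m k (t + 2 + m)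

/-- The gates are written out and at the same time reversed onto `D`, where `inverseProg` reads
them. -/
def copyProg : Prog Reg Sym := .loop .I always fun a => .seq (.push .R a) (.push .D a)

/-- The arguments of the two checks are the literal numbers 0 and 1: the output qubit and the
postselection qubit. -/
def roundProg : Prog Reg Sym :=
  .seq copyProg (.seq (check (.push .R .sep)) (.seq (check (.seq (.push .R .tick) (.push .R .sep)))
    (.seq inverseProg (.seq ancillaProg restoreProg))))

def roundsProg : Prog Reg Sym := .loop .Q always fun _ => roundProg

/-- The gates of the amplified circuit, where `G` and `G'` describe a circuit and its inverse. -/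
def amplifyStr (G G' : List Sym) (w m : ℕ) : List Sym :=
  bellStr w 0 (w + m) ++ strX (w + m + w) ++ roundsStr G G' w m (w + 1) (w + m + w) ++
    strC 0 (w + m + w + (w + 1) * (2 + m)) ++ strC (w + m + w + (w + 1) * (2 + m)) 0

/-- A loop that exits on a separator also removes it. The initial tick on `Q` makes the number of
rounds one more than the number of witness qubits. -/
def parseProg : Prog Reg Sym :=
  .seq (.loop .D always fun a => .push .I a) (.seq (.push .Q .tick)
    (.seq (.loop .I isTick fun _ => .seq (.push .W .tick) (.seq (.push .Q .tick) (.push .T .tick)))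
      (.loop .I isTick fun _ => .seq (.push .M .tick) (.push .T .tick))))

/-- The header comes last because `T` reaches the index of the last qubit only now; one more tick
makes it the number of qubits. The remaining stacks are cleared since a machine must halt with only
its output. -/
def finishProg : Prog Reg Sym :=
  .seq (.push .R .symC) (.seq (.push .R .sep) (.seq (emit .T) (.seq (.push .R .symC)
    (.seq (emit .T) (.seq (.push .R .sep) (.seq (.loop .R always fun a => .push .O a)
    (.seq (.push .O .sep) (.seq (.push .T .tick) (.seq (.loop .T always fun _ => .push .O .tick)
    (.seq (.push .O .sep) (.seq (.loop .M always fun _ => .skip)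
    (.seq (.loop .J always fun _ => .skip) (.loop .I always fun _ => .skip)))))))))))))

def amplifyProg : Prog Reg Sym :=
  .seq parseProg (.seq bellProg (.seq (.push .R .symX) (.seq (emit .T)
    (.seq roundsProg finishProg))))

section Programs

variable {i d w m e j q t r p f o : List Sym}

theorem runs_copyProg (l d r : List Sym) : Runs copyProg (st l d w m e j q t r p f o)
    (st [] (l.reverse ++ d) w m e j q t (l.reverse ++ r) p f o) (3 * l.length + 1) := by
  induction l generalizing d r with
  | nil => exact loop_I_nil
  | cons a l ih =>
    exact runs_of_eq (loop_I_cons rfl (push_R a |>.seq <| push_D a) (ih _ _)) rfl (by simp)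
      (by simp; omega)

theorem runs_roundProg {N : ℕ} (gs : List (Gate N)) (a x n : ℕ) (r : List Sym) :
    Runs roundProg
      (st (gs.flatMap Gate.encode) [] w (ticks a) [] (ticks x) q (ticks n) r [] [] o)
      (st (gs.flatMap Gate.encode) [] w (ticks a) [] (ticks x) q (ticks (n + 2 + a))
        ((roundStr (gs.flatMap Gate.encode) ((inverseGates gs).flatMap Gate.encode) x a n).reverse
          ++ r) [] [] o)
      (43 * (gs.flatMap Gate.encode).length + 20 * n + 50 +
        a * (15 * (x + a) + 10 * (n + 2 + a) + 33)) := by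
  have h := (runs_copyProg (w := w) (m := ticks a) (e := []) (j := ticks x) (q := q) (t := ticks n)
    (p := []) (f := []) (o := o) (gs.flatMap Gate.encode) [] r).seq
    ((runs_check (x := 0) fun r => push_R .sep).seq ((runs_check (x := 1) (n := n + 1)
      fun r => (push_R .tick).seq (push_R .sep)).seq
    ((runs_of_eq (runs_inverseProg gs [] _) (by rw [List.append_nil]) rfl le_rfl).seq
    (runs_ancillaProg_restoreProg a x (n + 2) _))))
  refine runs_of_eq h rfl ?_ ?_
  · simp [roundStr]
  · ring_nf
    omega

theorem runs_roundsProg {N : ℕ} (gs : List (Gate N)) (a x k n : ℕ) (r : List Sym) :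
    Runs roundsProg
      (st (gs.flatMap Gate.encode) [] w (ticks a) [] (ticks x) (ticks k) (ticks n) r [] [] o)
      (st (gs.flatMap Gate.encode) [] w (ticks a) [] (ticks x) [] (ticks (n + k * (2 + a)))
        ((roundsStr (gs.flatMap Gate.encode) ((inverseGates gs).flatMap Gate.encode) x a k
          n).reverse ++ r) [] [] o)
      (k * (43 * (gs.flatMap Gate.encode).length + 20 * (n + k * (2 + a)) + 51 +
        a * (15 * (x + a) + 10 * (n + k * (2 + a) + 2 + a) + 33)) + 1) := by
  induction k generalizing n r with
  | zero => exact runs_of_eq loop_Q_nil rfl (by simp [roundsStr]) (by omega)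
  | succ k ih =>
    have h := ih (n + 2 + a) ((roundStr (gs.flatMap Gate.encode)
      ((inverseGates gs).flatMap Gate.encode) x a n).reverse ++ r)
    have e₁ : n + 2 + a + k * (2 + a) = n + (k + 1) * (2 + a) := by ring
    refine runs_of_eq (loop_Q_cons (a := .tick) rfl (runs_roundProg gs a x n r) h) rfl ?_ ?_
    · rw [e₁]
      simp [roundsStr]
    · rw [e₁]
      set B := n + (k + 1) * (2 + a) with hB
      have : n ≤ B := by omega
      have h₂ : a * (15 * (x + a) + 10 * (n + 2 + a) + 33) ≤
          a * (15 * (x + a) + 10 * (B + 2 + a) + 33) := by gcongr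
      rw [add_mul k, one_mul]
      omega

theorem runs_parseProg (a b : ℕ) (G : List Sym) :
    Runs parseProg (st [] (encodeNat a ++ encodeNat b ++ G).reverse [] [] [] [] [] [] [] [] [] [])
      (st G [] (ticks a) (ticks b) [] [] (ticks (a + 1)) (ticks (a + b)) [] [] [] [])
      (6 * a + 5 * b + 2 * G.length + 8) := by
  have h₁ : ∀ l i, Runs (.loop .D always fun a => .push .I a)
      (st i l [] [] [] [] [] [] [] [] [] [])
      (st (l.reverse ++ i) [] [] [] [] [] [] [] [] [] [] []) (2 * l.length + 1) := by
    intro l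
    induction l with
    | nil => exact fun i => loop_D_nil
    | cons a l ih =>
      exact fun i => runs_of_eq (loop_D_cons rfl (push_I a) (ih _)) rfl (by simp) (by simp; omega)
  have h₂ : ∀ a x i q t, Runs (.loop .I isTick fun _ =>
        .seq (.push .W .tick) (.seq (.push .Q .tick) (.push .T .tick)))
      (st (encodeNat a ++ i) [] (ticks x) [] [] [] (ticks q) (ticks t) [] [] [] [])
      (st i [] (ticks (x + a)) [] [] [] (ticks (q + a)) (ticks (t + a)) [] [] [] [])
      (4 * a + 1) := by
    intro a
    induction a with
    | zero => exact fun x i q t => loop_I_exit rfl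
    | succ a ih =>
      intro x i q t
      exact runs_of_eq (loop_I_cons (a := .tick) rfl ((push_W .tick).seq ((push_Q .tick).seq
        (push_T .tick))) (ih (x + 1) i (q + 1) (t + 1))) rfl
        (by simp only [show ∀ y, y + 1 + a = y + (a + 1) by intro y; ring]) (by omega)
  have h₃ : ∀ b x i w q t, Runs (.loop .I isTick fun _ =>
        .seq (.push .M .tick) (.push .T .tick))
      (st (encodeNat b ++ i) [] w (ticks x) [] [] q (ticks t) [] [] [] [])
      (st i [] w (ticks (x + b)) [] [] q (ticks (t + b)) [] [] [] []) (3 * b + 1) := by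
    intro a
    induction a with
    | zero => exact fun x i w q t => loop_I_exit rfl
    | succ a ih =>
      intro x i w q t
      exact runs_of_eq (loop_I_cons (a := .tick) rfl ((push_M .tick).seq
        (push_T .tick)) (ih (x + 1) i w q (t + 1))) rfl
        (by simp only [show ∀ y, y + 1 + a = y + (a + 1) by intro y; ring]) (by omega)
  refine runs_of_eq ((h₁ _ []).seq ((push_Q .tick).seq ((runs_of_eq (h₂ a 0 (encodeNat b ++ G) 1 0)
    (by simp) rfl le_rfl).seq (h₃ b 0 G _ _ _)))) rfl (by simp only [Nat.zero_add, Nat.add_comm 1]) ?_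
  simp [encodeNat]
  omega

theorem runs_finishProg (G : List Sym) (a x n : ℕ) (r : List Sym) :
    Runs finishProg (st G [] [] (ticks a) [] (ticks x) [] (ticks n) r [] [] [])
      (st [] [] [] [] [] [] [] [] [] [] [] (encodeNat 0 ++ encodeNat (n + 1) ++
        (r.reverse ++ strC 0 n ++ strC n 0)))
      (2 * r.length + 16 * n + 2 * a + 2 * x + 2 * G.length + 50) := by
  have h₁ : ∀ l o, Runs (.loop .R always fun a => .push .O a)
      (st G [] [] (ticks a) [] (ticks x) [] (ticks n) l [] [] o)
      (st G [] [] (ticks a) [] (ticks x) [] (ticks n) [] [] [] (l.reverse ++ o))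
      (2 * l.length + 1) := by
    intro l
    induction l with
    | nil => exact fun i => loop_R_nil
    | cons a l ih =>
      exact fun i => runs_of_eq (loop_R_cons rfl (push_O a) (ih _)) rfl (by simp) (by simp; omega)
  have h₂ : ∀ n o, Runs (.loop .T always fun _ => .push .O .tick)
      (st G [] [] (ticks a) [] (ticks x) [] (ticks n) [] [] [] o)
      (st G [] [] (ticks a) [] (ticks x) [] [] [] [] [] (ticks n ++ o)) (2 * n + 1) := by
    intro n
    induction n with
    | zero => exact fun i => loop_T_nil
    | succ n ih =>
      exact fun i => runs_of_eq (loop_T_cons (a := .tick) rfl (push_O .tick) (ih _)) rfl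
        (by rw [ticks_append_cons]) (by omega)
  have h₃ : ∀ n o, Runs (.loop .M always fun _ => .skip)
      (st G [] [] (ticks n) [] (ticks x) [] [] [] [] [] o)
      (st G [] [] [] [] (ticks x) [] [] [] [] [] o) (2 * n + 1) := by
    intro n o
    induction n with
    | zero => exact loop_M_nil
    | succ n ih =>
      exact runs_of_eq (loop_M_cons (a := .tick) rfl (Runs.skip _) ih) rfl rfl (by omega)
  have h₄ : ∀ n o, Runs (.loop .J always fun _ => .skip)
      (st G [] [] [] [] (ticks n) [] [] [] [] [] o)
      (st G [] [] [] [] [] [] [] [] [] [] o) (2 * n + 1) := by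
    intro n o
    induction n with
    | zero => exact loop_J_nil
    | succ n ih =>
      exact runs_of_eq (loop_J_cons (a := .tick) rfl (Runs.skip _) ih) rfl rfl (by omega)
  have h₅ : ∀ G o, Runs (.loop .I always fun _ => .skip)
      (st G [] [] [] [] [] [] [] [] [] [] o)
      (st [] [] [] [] [] [] [] [] [] [] [] o) (2 * G.length + 1) := by
    intro G o
    induction G with
    | nil => exact loop_I_nil
    | cons a G ih =>
      exact runs_of_eq (loop_I_cons rfl (Runs.skip _) ih) rfl rfl (by simp; omega)
  refine runs_of_eq ((push_R .symC).seq ((push_R .sep).seq (runs_emit_T.seq ((push_R .symC).seq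
    (runs_emit_T.seq ((push_R .sep).seq ((h₁ _ []).seq ((push_O .sep).seq ((push_T .tick).seq
    ((h₂ (n + 1) _).seq ((push_O .sep).seq ((h₃ a _).seq ((h₄ x _).seq (h₅ G _))))))))))))))
    rfl ?_ ?_
  · simp [encodeNat, strC]
  · simp [encodeNat]
    omega

/-- A unit of time pushes at most one symbol. Thus the running time so far bounds the length of `R`,
and the length of the written gates need not be computed. -/
theorem length_le_of_runs {p : Prog Reg Sym} {S S' : Reg → List Sym} {n : ℕ} (h : Runs p S S' n)
    (k : Reg) : (S' k).length ≤ (S k).length + n := by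
  induction h with
  | skip S => omega
  | push k' a S =>
    by_cases hk : k = k'
    · subst hk
      simp
    · simp [hk]
  | seq _ _ ih₁ ih₂ => omega
  | @loop_exit k' c body S hS =>
    by_cases hk : k = k'
    · subst hk
      simp only [update_self, List.length_tail]
      omega
    · simp [hk]
  | @loop_step k' c body S S' S'' a l t t' hS hc _ _ ih₁ ih₂ =>
    by_cases hk : k = k'
    · subst hk
      simp only [update_self] at ih₁
      rw [hS, List.length_cons]
      omega
    · rw [update_of_ne hk] at ih₁
      omega
  | mono _ ht ih => omega

/-- A bound on the time that `amplifyProg` takes before it finishes. -/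
def amplifyTime {A : Type*} [Semiring A] (a b g : A) : A :=
  (6 * a + 5 * b + 2 * g + 8) + (a * (10 * a + 5 * (a + b + a) + 14) + 1) + 1 +
    (5 * (a + b + a) + 3) + ((a + 1) * (43 * g + 20 * (a + b + a + (a + 1) * (2 + b)) + 51 +
      b * (15 * (a + b) + 10 * (a + b + a + (a + 1) * (2 + b) + 2 + b) + 33)) + 1)

/-- A bound on the time that `amplifyProg` takes. -/
def amplifyTotalTime {A : Type*} [Semiring A] (a b g : A) : A :=
  amplifyTime a b g + (2 * amplifyTime a b g + 16 * (a + b + a + (a + 1) * (2 + b)) + 2 * b +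
    2 * a + 2 * g + 50)

theorem runs_amplifyProg {N : ℕ} (a b : ℕ) (gs : List (Gate N)) :
    Runs amplifyProg
      (st [] (encodeNat a ++ encodeNat b ++ gs.flatMap Gate.encode).reverse
        [] [] [] [] [] [] [] [] [] [])
      (st [] [] [] [] [] [] [] [] [] [] [] (encodeNat 0 ++
        encodeNat (a + b + a + (a + 1) * (2 + b) + 1) ++ amplifyStr (gs.flatMap Gate.encode)
          ((inverseGates gs).flatMap Gate.encode) a b))
      (amplifyTotalTime a b (gs.flatMap Gate.encode).length) := by
  have h₁ := runs_bellProg (i := gs.flatMap Gate.encode) (d := []) (m := ticks b) (e := [])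
    (q := ticks (a + 1)) (f := []) (o := []) a 0 (a + b) []
  rw [Nat.zero_add] at h₁
  have h₂ := (runs_parseProg a b (gs.flatMap Gate.encode)).seq (h₁.seq
    ((push_R .symX).seq (runs_emit_T.seq (runs_roundsProg gs b a (a + 1) (a + b + a) _))))
  have hR := length_le_of_runs h₂ .R
  simp only [st, List.length_nil] at hR
  refine runs_of_eq ((runs_parseProg a b (gs.flatMap Gate.encode)).seq (h₁.seq
    ((push_R .symX).seq (runs_emit_T.seq ((runs_roundsProg gs b a (a + 1) (a + b + a) _).seq
    (runs_finishProg _ _ _ _ _)))))) rfl ?_ ?_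
  · simp [amplifyStr]
  · simp only [amplifyTotalTime, amplifyTime]
    omega

/-- Since the time bound is an expression over any semiring, it serves both as a number and as a
polynomial; a common bound `L` for the three sizes reduces it to one variable. -/
theorem amplifyTotalTime_mono {a b g L : ℕ} (ha : a ≤ L) (hb : b ≤ L) (hg : g ≤ L) :
    amplifyTotalTime a b g ≤ (amplifyTotalTime Polynomial.X Polynomial.X Polynomial.X :
      Polynomial ℕ).eval L := by
  have : (amplifyTotalTime Polynomial.X Polynomial.X Polynomial.X : Polynomial ℕ).eval L =
      amplifyTotalTime L L L := by
    simp [amplifyTotalTime, amplifyTime]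
  rw [this]
  simp only [amplifyTotalTime, amplifyTime]
  gcongr

end Programs

/-- If the descriptions of the circuits `f C` are those of amplified circuits, then `f` preserves
uniformity. -/
theorem Uniform.amplify {Q : List Bool → Circuit} (hQ : Uniform Q) (f : Circuit → Circuit)
    (hf : ∀ C, (f C).encode = encodeNat 0 ++ encodeNat (C.witness + C.ancilla + C.witness +
      (C.witness + 1) * (2 + C.ancilla) + 1) ++ amplifyStr (C.gates.flatMap Gate.encode)
        ((inverseGates C.gates).flatMap Gate.encode) C.witness C.ancilla) :
    Uniform (f ∘ Q) := by
  obtain ⟨hQ⟩ := hQ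
  refine polyTime_comp hQ amplifyProg .D .O (amplifyTotalTime .X .X .X) fun C => ?_
  refine runs_of_eq (runs_amplifyProg C.witness C.ancilla C.gates) ?_ ?_
    (amplifyTotalTime_mono ?_ ?_ ?_)
  · funext k
    cases k <;> simp [st, onlyStk, Circuit.encode]
  · rw [← hf]
    funext k
    cases k <;> simp [st, onlyStk]
  all_goals
    simp only [Circuit.encode, encodeNat, List.length_append, List.length_replicate]
    omega

end MerlinQC

/-! ### The action of gates on state vectors -/

namespace MerlinQC

open Matrix Function

/-- State vectors of `N` qubits. -/
abbrev Vec (N : ℕ) : Type := (Fin N → Bool) → ℂ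

/-- Apply the gates of a list in order. -/
noncomputable def run {N : ℕ} (gs : List (Gate N)) (v : Vec N) : Vec N :=
  gs.foldl (fun v g => g.matrix *ᵥ v) v

@[simp] theorem run_nil {N : ℕ} (v : Vec N) : run [] v = v := rfl

@[simp] theorem run_cons {N : ℕ} (g : Gate N) (gs : List (Gate N)) (v : Vec N) :
    run (g :: gs) v = run gs (g.matrix *ᵥ v) := rfl

@[simp] theorem run_append {N : ℕ} (gs gs' : List (Gate N)) (v : Vec N) :
    run (gs ++ gs') v = run gs' (run gs v) := List.foldl_append ..

/-- The unitary matrix of a list of gates. -/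
noncomputable def listMatrix {N : ℕ} (gs : List (Gate N)) : Op N :=
  gs.foldl (fun U g => g.matrix * U) 1

theorem foldl_matrix_mul {N : ℕ} (gs : List (Gate N)) (A : Op N) :
    gs.foldl (fun U g => g.matrix * U) A = listMatrix gs * A := by
  unfold listMatrix
  induction gs generalizing A with
  | nil => simp
  | cons g gs ih => rw [List.foldl_cons, List.foldl_cons, ih, ih (g.matrix * 1)]; simp [mul_assoc]

theorem listMatrix_cons {N : ℕ} (g : Gate N) (gs : List (Gate N)) :
    listMatrix (g :: gs) = listMatrix gs * g.matrix := by
  rw [← foldl_matrix_mul]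
  simp [listMatrix]

theorem run_eq_listMatrix_mulVec {N : ℕ} (gs : List (Gate N)) (v : Vec N) :
    run gs v = listMatrix gs *ᵥ v := by
  induction gs generalizing v with
  | nil => simp [listMatrix]
  | cons g gs ih => rw [run_cons, ih, listMatrix_cons, mulVec_mulVec]

/-- A permutation matrix pulls a vector back along the inverse permutation, which for an involution
is the permutation itself. -/
theorem of_involutive_mulVec {N : ℕ} {π : (Fin N → Bool) → Fin N → Bool} (hπ : Involutive π)
    (v : Vec N) (b : Fin N → Bool) :
    ((Matrix.of fun b c => if b = π c then 1 else 0 : Op N) *ᵥ v) b = v (π b) := by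
  simp only [mulVec, dotProduct, of_apply, ite_mul, one_mul, zero_mul]
  rw [Finset.sum_eq_single (π b)]
  · simp [hπ b]
  · intro c _ hc
    rw [if_neg]
    rintro rfl
    exact hc (hπ c).symm
  · simp

theorem involutive_not {N : ℕ} (i : Fin N) :
    Involutive fun c : Fin N → Bool => update c i (!(c i)) := by
  intro c
  simp

theorem involutive_xor {N : ℕ} (t : Fin N) (f : (Fin N → Bool) → Bool)
    (hf : ∀ c x, f (update c t x) = f c) :
    Involutive fun c : Fin N → Bool => update c t (xor (c t) (f c)) := by
  intro c
  simp [hf]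

theorem xGate_mulVec {N : ℕ} (i : Fin N) (v : Vec N) (b : Fin N → Bool) :
    ((Gate.xGate i).matrix *ᵥ v) b = v (update b i (!(b i))) :=
  of_involutive_mulVec (involutive_not i) v b

theorem cnot_mulVec {N : ℕ} (k t : Fin N) (h : k ≠ t) (v : Vec N) (b : Fin N → Bool) :
    ((Gate.cnot k t h).matrix *ᵥ v) b = v (update b t (xor (b t) (b k))) :=
  of_involutive_mulVec (involutive_xor t (fun c => c k) (by simp [h])) v b

theorem toffoli_mulVec {N : ℕ} (k l t : Fin N) (h₁ : k ≠ l) (h₂ : k ≠ t) (h₃ : l ≠ t) (v : Vec N)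
    (b : Fin N → Bool) :
    ((Gate.toffoli k l t h₁ h₂ h₃).matrix *ᵥ v) b = v (update b t (xor (b t) (b k && b l))) :=
  of_involutive_mulVec (involutive_xor t (fun c => c k && c l) (by simp [h₂, h₃])) v b

theorem tGate_mulVec {N : ℕ} (i : Fin N) (v : Vec N) (b : Fin N → Bool) :
    ((Gate.tGate i).matrix *ᵥ v) b =
      (if b i = true then Complex.exp (Complex.I * (Real.pi : ℂ) / 4) else 1) * v b :=
  mulVec_diagonal ..

theorem hadamard_mulVec {N : ℕ} (i : Fin N) (v : Vec N) (b : Fin N → Bool) :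
    ((Gate.hadamard i).matrix *ᵥ v) b = (((Real.sqrt 2)⁻¹ : ℝ) : ℂ) *
      (v (update b i false) + (if b i = true then -1 else 1) * v (update b i true)) := by
  simp only [mulVec, dotProduct, Gate.matrix, of_apply]
  rw [Finset.sum_eq_add (update b i false) (update b i true)]
  · have h : ∀ x j, j ≠ i → b j = update b i x j := fun x j hj => (update_of_ne hj x b).symm
    rw [if_pos (h false), if_pos (h true)]
    simp
    split_ifs <;> ring
  · intro h
    simpa using congrFun h i
  · rintro c - ⟨h₁, h₂⟩
    rw [if_neg, zero_mul]
    intro h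
    cases hc : c i
    · refine h₁ (funext fun j => ?_)
      by_cases hj : j = i
      · subst hj
        simp [hc]
      · simp [hj, h j hj]
    · refine h₂ (funext fun j => ?_)
      by_cases hj : j = i
      · subst hj
        simp [hc]
      · simp [hj, h j hj]
  · simp
  · simp

theorem sqrt_two_inv_mul_self :
    (((Real.sqrt 2)⁻¹ : ℝ) : ℂ) * (((Real.sqrt 2)⁻¹ : ℝ) : ℂ) = 1 / 2 := by
  rw [← Complex.ofReal_mul, ← mul_inv, Real.mul_self_sqrt (by norm_num)]
  norm_num

theorem Op.ext_mulVec {N : ℕ} {A B : Op N} (h : ∀ v b, (A *ᵥ v) b = (B *ᵥ v) b) : A = B :=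
  Matrix.toLin'.injective (LinearMap.ext fun v => funext fun b => h v b)

theorem isHermitian_of_involutive {N : ℕ} {π : (Fin N → Bool) → Fin N → Bool}
    (hπ : Involutive π) : (Matrix.of fun b c => if b = π c then 1 else 0 : Op N)ᴴ =
      (Matrix.of fun b c => if b = π c then 1 else 0 : Op N) := by
  ext b c
  simp only [conjTranspose_apply, of_apply]
  by_cases h : b = π c
  · have h' : c = π b := by rw [h, hπ c]
    rw [if_pos h, if_pos h', star_one]
  · have h' : ¬ c = π b := fun h' => h (by rw [h', hπ b])
    rw [if_neg h, if_neg h', star_zero]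

theorem mul_self_of_involutive {N : ℕ} {π : (Fin N → Bool) → Fin N → Bool}
    (hπ : Involutive π) : (Matrix.of fun b c => if b = π c then 1 else 0 : Op N) *
      (Matrix.of fun b c => if b = π c then 1 else 0 : Op N) = 1 := by
  refine Op.ext_mulVec fun v b => ?_
  rw [← mulVec_mulVec, of_involutive_mulVec hπ, of_involutive_mulVec hπ, hπ, one_mulVec]

theorem hadamard_isHermitian {N : ℕ} (i : Fin N) :
    (Gate.hadamard i).matrixᴴ = (Gate.hadamard i).matrix := by
  ext b c
  simp only [conjTranspose_apply, Gate.matrix, of_apply, and_comm (a := c i = true)]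
  by_cases h : ∀ j, j ≠ i → b j = c j
  · rw [if_pos h, if_pos fun j hj => (h j hj).symm, star_mul', Complex.star_def, Complex.conj_ofReal]
    split_ifs <;> simp
  · rw [if_neg h, if_neg fun h' => h fun j hj => (h' j hj).symm, star_zero]

theorem hadamard_mul_self {N : ℕ} (i : Fin N) :
    (Gate.hadamard i).matrix * (Gate.hadamard i).matrix = 1 := by
  refine Op.ext_mulVec fun v b => ?_
  rw [← mulVec_mulVec, hadamard_mulVec, hadamard_mulVec, hadamard_mulVec, one_mulVec]
  simp only [update_idem, update_self, Bool.false_eq_true, if_false, if_true]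
  cases h : b i
  · have : update b i false = b := by rw [← h, update_eq_self]
    rw [this]
    simp only [Bool.false_eq_true, if_false]
    linear_combination 2 * v b * sqrt_two_inv_mul_self
  · have : update b i true = b := by rw [← h, update_eq_self]
    rw [this]
    simp only [if_true]
    linear_combination 2 * v b * sqrt_two_inv_mul_self

/-- Every gate except `T` is a Hermitian involution, and the phase of `T` is an eighth root of
unity. Thus inverses are available although the gate set lacks the inverse of `T`. -/
theorem Gate.pow_seven {N : ℕ} (g : Gate N) : g.matrix ^ 7 = g.matrixᴴ := by
  have key : ∀ A : Op N, Aᴴ = A → A * A = 1 → A ^ 7 = Aᴴ := by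
    intro A h₁ h₂
    rw [h₁, show A ^ 7 = (A * A) ^ 3 * A by noncomm_ring, h₂, one_pow, one_mul]
  cases g with
  | hadamard i => exact key _ (hadamard_isHermitian i) (hadamard_mul_self i)
  | tGate i =>
    simp only [Gate.matrix, diagonal_pow, diagonal_conjTranspose]
    congr 1
    funext b
    simp only [Pi.pow_apply, Pi.star_apply]
    split_ifs
    · rw [← Complex.exp_nat_mul, Complex.star_def, ← Complex.exp_conj, Complex.exp_eq_exp_iff_exists_int]
      -- The angles `7π/4` and `-π/4` differ by one full period.
      refine ⟨1, ?_⟩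
      simp [map_ofNat (starRingEnd ℂ) 4]
      ring
    · simp
  | xGate i =>
    exact key _ (isHermitian_of_involutive (involutive_not i))
      (mul_self_of_involutive (involutive_not i))
  | cnot k t h =>
    have := involutive_xor t (fun c => c k) (by simp [h])
    exact key _ (isHermitian_of_involutive this) (mul_self_of_involutive this)
  | toffoli k l t h₁ h₂ h₃ =>
    have := involutive_xor t (fun c => c k && c l) (by simp [h₂, h₃])
    exact key _ (isHermitian_of_involutive this) (mul_self_of_involutive this)

theorem run_replicate {N : ℕ} (n : ℕ) (g : Gate N) (v : Vec N) :
    run (List.replicate n g) v = (g.matrix ^ n) *ᵥ v := by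
  induction n generalizing v with
  | zero => simp
  | succ n ih => rw [List.replicate_succ, run_cons, ih, mulVec_mulVec, pow_succ]

theorem run_inverseGates {N : ℕ} (gs : List (Gate N)) (v : Vec N) :
    run (inverseGates gs) v = (listMatrix gs)ᴴ *ᵥ v := by
  induction gs generalizing v with
  | nil => simp [inverseGates, listMatrix]
  | cons g gs ih =>
    have : inverseGates (g :: gs) = inverseGates gs ++ List.replicate 7 g := by
      simp [inverseGates, List.flatMap_append]
    rw [this, run_append, ih, run_replicate, Gate.pow_seven, mulVec_mulVec, listMatrix_cons,
      conjTranspose_mul]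

/-- A gate on other qubits. -/
def Gate.map {N M : ℕ} (f : Fin N ↪ Fin M) : Gate N → Gate M
  | .hadamard i => .hadamard (f i)
  | .tGate i => .tGate (f i)
  | .xGate i => .xGate (f i)
  | .cnot c t h => .cnot (f c) (f t) (f.injective.ne h)
  | .toffoli a b t h₁ h₂ h₃ =>
    .toffoli (f a) (f b) (f t) (f.injective.ne h₁) (f.injective.ne h₂) (f.injective.ne h₃)

theorem Gate.encode_map {N M : ℕ} (f : Fin N ↪ Fin M) (hf : ∀ i, (f i : ℕ) = i) (g : Gate N) :
    (g.map f).encode = g.encode := by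
  cases g <;> simp [Gate.map, Gate.encode, hf]

theorem extend_update_comp {N M : ℕ} (f : Fin N ↪ Fin M) (b : Fin M → Bool) (i : Fin N) (x : Bool) :
    extend f (update (b ∘ f) i x) b = update b (f i) x := by
  funext j
  by_cases hj : ∃ k, f k = j
  · obtain ⟨k, rfl⟩ := hj
    rw [f.injective.extend_apply]
    by_cases hk : k = i
    · subst hk
      simp
    · simp [hk]
  · rw [extend_apply' _ _ _ hj, update_of_ne]
    rintro rfl
    exact hj ⟨i, rfl⟩

theorem extend_comp_self {N M : ℕ} (f : Fin N ↪ Fin M) (b : Fin M → Bool) :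
    extend f (b ∘ f) b = b := by
  funext j
  by_cases hj : ∃ k, f k = j
  · obtain ⟨k, rfl⟩ := hj
    rw [f.injective.extend_apply]
    rfl
  · rw [extend_apply' _ _ _ hj]

theorem extend_extend {N M : ℕ} (f : Fin N ↪ Fin M) (a a' : Fin N → Bool) (b : Fin M → Bool) :
    extend f a (extend f a' b) = extend f a b := by
  funext j
  by_cases hj : ∃ k, f k = j
  · obtain ⟨k, rfl⟩ := hj
    rw [f.injective.extend_apply, f.injective.extend_apply]
  · rw [extend_apply' _ _ _ hj, extend_apply' _ _ _ hj, extend_apply' _ _ _ hj]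

/-- A gate is local: with the qubits outside the range of `f` frozen at their values in `b`, it acts
as on `N` qubits. -/
theorem map_mulVec {N M : ℕ} (f : Fin N ↪ Fin M) (g : Gate N) (v : Vec M) (b : Fin M → Bool) :
    ((g.map f).matrix *ᵥ v) b = (g.matrix *ᵥ fun a => v (extend f a b)) (b ∘ f) := by
  cases g <;> simp only [Gate.map, hadamard_mulVec, tGate_mulVec, xGate_mulVec, cnot_mulVec,
    toffoli_mulVec, extend_update_comp, extend_comp_self, Function.comp_apply]

theorem run_map {N M : ℕ} (f : Fin N ↪ Fin M) (gs : List (Gate N)) (v : Vec M)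
    (b : Fin M → Bool) :
    run (gs.map (Gate.map f)) v b = run gs (fun a => v (extend f a b)) (b ∘ f) := by
  induction gs generalizing v with
  | nil => simp [extend_comp_self]
  | cons g gs ih =>
    rw [List.map_cons, run_cons, ih, run_cons]
    congr 2
    funext a
    have : extend f a b ∘ f = a := funext fun i => f.injective.extend_apply ..
    rw [map_mulVec, this]
    simp only [extend_extend]

end MerlinQC

/-! ### The amplified circuit -/

namespace MerlinQC

open Matrix Function

/-! ### Bits addressed by natural numbers -/

section Bits

variable {M : ℕ}

/-- The `i`-th bit, or `false` if there is none. -/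
def bit (b : Fin M → Bool) (i : ℕ) : Bool := if h : i < M then b ⟨i, h⟩ else false

/-- Set the `i`-th bit, if there is one. -/
def setBit (b : Fin M → Bool) (i : ℕ) (x : Bool) : Fin M → Bool :=
  if h : i < M then update b ⟨i, h⟩ x else b

theorem bit_val (b : Fin M → Bool) (i : Fin M) : bit b i = b i := by simp [bit]

theorem bit_of_le (b : Fin M → Bool) {i : ℕ} (h : M ≤ i) : bit b i = false := by
  simp [bit, h]

theorem bit_ext {b c : Fin M → Bool} (h : ∀ i, bit b i = bit c i) : b = c :=
  funext fun i => by rw [← bit_val b, ← bit_val c, h]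

theorem bit_setBit (b : Fin M → Bool) {i : ℕ} (h : i < M) (x : Bool) (j : ℕ) :
    bit (setBit b i x) j = if j = i then x else bit b j := by
  unfold bit setBit
  rw [dif_pos h]
  by_cases hj : j < M
  · simp only [hj, dif_pos, update_apply, Fin.mk.injEq]
  · rw [dif_neg hj, dif_neg hj, if_neg (by omega)]

theorem setBit_bit (b : Fin M → Bool) (i : ℕ) : setBit b i (bit b i) = b := by
  unfold bit setBit
  split_ifs <;> simp

theorem bit_comp_castLE {N : ℕ} (h : N ≤ M) (b : Fin M → Bool) {i : ℕ} (hi : i < N) :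
    bit (b ∘ Fin.castLEEmb h) i = bit b i := by
  simp [bit, hi, hi.trans_le h]

theorem bit_extend {N : ℕ} (h : N ≤ M) (a : Fin N → Bool) (b : Fin M → Bool) (i : ℕ) :
    bit (extend (Fin.castLEEmb h) a b) i = if i < N then bit a i else bit b i := by
  by_cases hi : i < N
  · have := (Fin.castLEEmb h).injective.extend_apply a b ⟨i, hi⟩
    simp only [hi, if_true]
    unfold bit
    rw [dif_pos (hi.trans_le h), dif_pos hi]
    exact this
  · rw [if_neg hi]
    unfold bit
    split_ifs with h'
    · refine extend_apply' _ _ _ ?_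
      rintro ⟨k, hk⟩
      have := congrArg Fin.val hk
      simp at this
      omega
    · rfl

end Bits

/-! ### The gate list and its description -/

section GatesAt

/-- Gates at positions given by numbers (no gate if the positions make no sense). -/
def gatesH (M i : ℕ) : List (Gate M) := if h : i < M then [.hadamard ⟨i, h⟩] else []

def gatesX (M i : ℕ) : List (Gate M) := if h : i < M then [.xGate ⟨i, h⟩] else []

def gatesC (M c t : ℕ) : List (Gate M) :=
  if h : c < M ∧ t < M ∧ c ≠ t then [.cnot ⟨c, h.1⟩ ⟨t, h.2.1⟩ (by simpa using h.2.2)] else []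

def gatesF (M a b t : ℕ) : List (Gate M) :=
  if h : a < M ∧ b < M ∧ t < M ∧ a ≠ b ∧ a ≠ t ∧ b ≠ t then
    [.toffoli ⟨a, h.1⟩ ⟨b, h.2.1⟩ ⟨t, h.2.2.1⟩ (by simpa using h.2.2.2.1)
      (by simpa using h.2.2.2.2.1) (by simpa using h.2.2.2.2.2)] else []

variable {M : ℕ}

theorem run_gatesH {i : ℕ} (hi : i < M) (v : Vec M) (b : Fin M → Bool) :
    run (gatesH M i) v b = (((Real.sqrt 2)⁻¹ : ℝ) : ℂ) * (v (setBit b i false) +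
      (if bit b i = true then -1 else 1) * v (setBit b i true)) := by
  simp only [gatesH, setBit, bit, hi, dif_pos, run_cons, run_nil, hadamard_mulVec]

theorem run_gatesX {i : ℕ} (hi : i < M) (v : Vec M) (b : Fin M → Bool) :
    run (gatesX M i) v b = v (setBit b i (!(bit b i))) := by
  simp only [gatesX, setBit, bit, hi, dif_pos, run_cons, run_nil, xGate_mulVec]

theorem run_gatesC {c t : ℕ} (hc : c < M) (ht : t < M) (h : c ≠ t) (v : Vec M)
    (b : Fin M → Bool) : run (gatesC M c t) v b = v (setBit b t (xor (bit b t) (bit b c))) := by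
  have h' : c < M ∧ t < M ∧ c ≠ t := ⟨hc, ht, h⟩
  rw [gatesC, dif_pos h', run_cons, run_nil, cnot_mulVec]
  simp only [setBit, bit, hc, ht, dif_pos]

theorem run_gatesF {k l t : ℕ} (hk : k < M) (hl : l < M) (ht : t < M) (h₁ : k ≠ l) (h₂ : k ≠ t)
    (h₃ : l ≠ t) (v : Vec M) (b : Fin M → Bool) :
    run (gatesF M k l t) v b = v (setBit b t (xor (bit b t) (bit b k && bit b l))) := by
  have h' : k < M ∧ l < M ∧ t < M ∧ k ≠ l ∧ k ≠ t ∧ l ≠ t := ⟨hk, hl, ht, h₁, h₂, h₃⟩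
  rw [gatesF, dif_pos h', run_cons, run_nil, toffoli_mulVec]
  simp only [setBit, bit, hk, hl, ht, dif_pos]

theorem encode_gatesH {i : ℕ} (hi : i < M) : (gatesH M i).flatMap Gate.encode = strH i := by
  simp [gatesH, hi, Gate.encode]

theorem encode_gatesX {i : ℕ} (hi : i < M) : (gatesX M i).flatMap Gate.encode = strX i := by
  simp [gatesX, hi, Gate.encode]

theorem encode_gatesC {c t : ℕ} (hc : c < M) (ht : t < M) (h : c ≠ t) :
    (gatesC M c t).flatMap Gate.encode = strC c t := by
  simp [gatesC, hc, ht, h, Gate.encode]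

theorem encode_gatesF {k l t : ℕ} (hk : k < M) (hl : l < M) (ht : t < M) (h₁ : k ≠ l) (h₂ : k ≠ t)
    (h₃ : l ≠ t) : (gatesF M k l t).flatMap Gate.encode = strF k l t := by
  simp [gatesF, hk, hl, ht, h₁, h₂, h₃, Gate.encode]

/-- Postselection of `a` qubits from `x` on being `0`, with chain qubits from `t` on. -/
def ancillaGates (M : ℕ) : ℕ → ℕ → ℕ → List (Gate M)
  | 0, _, _ => []
  | a + 1, x, t => gatesX M x ++ gatesF M t x (t + 1) ++ gatesX M x ++
      ancillaGates M a (x + 1) (t + 1)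

/-- Bell pairs of the `a` qubits from `x` on with the qubits from `t` on. -/
def bellGates (M : ℕ) : ℕ → ℕ → ℕ → List (Gate M)
  | 0, _, _ => []
  | a + 1, x, t => gatesH M x ++ gatesC M x t ++ bellGates M a (x + 1) (t + 1)

variable {N : ℕ} (h : N ≤ M) (gs : List (Gate N))

def roundGates (w m t : ℕ) : List (Gate M) :=
  gs.map (Gate.map (Fin.castLEEmb h)) ++ gatesF M t 0 (t + 1) ++ gatesF M (t + 1) 1 (t + 2) ++
    (inverseGates gs).map (Gate.map (Fin.castLEEmb h)) ++ ancillaGates M m w (t + 2)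

def roundsGates (w m : ℕ) : ℕ → ℕ → List (Gate M)
  | 0, _ => []
  | k + 1, t => roundGates h gs w m t ++ roundsGates w m k (t + 2 + m)

/-- The gates of the amplified circuit. -/
def amplifyGates (w m : ℕ) : List (Gate M) :=
  bellGates M w 0 (w + m) ++ gatesX M (w + m + w) ++
    roundsGates h gs w m (w + 1) (w + m + w) ++
    gatesC M 0 (w + m + w + (w + 1) * (2 + m)) ++ gatesC M (w + m + w + (w + 1) * (2 + m)) 0

theorem encode_map_castLE : (gs.map (Gate.map (Fin.castLEEmb h))).flatMap Gate.encode =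
    gs.flatMap Gate.encode := by
  rw [List.flatMap_map]
  congr 1
  funext g
  exact g.encode_map _ fun i => rfl

theorem encode_ancillaGates (a x t : ℕ) (hx : x + a ≤ t) (ht : t + a < M) :
    (ancillaGates M a x t).flatMap Gate.encode = ancillaStr a x t := by
  induction a generalizing x t with
  | zero => rfl
  | succ a ih =>
    simp only [ancillaGates, ancillaStr, List.flatMap_append]
    rw [encode_gatesX (by omega), encode_gatesF (by omega) (by omega) (by omega) (by omega)
      (by omega) (by omega), ih (x + 1) (t + 1) (by omega) (by omega)]

theorem encode_bellGates (a x t : ℕ) (hx : x + a ≤ t) (ht : t + a ≤ M) :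
    (bellGates M a x t).flatMap Gate.encode = bellStr a x t := by
  induction a generalizing x t with
  | zero => rfl
  | succ a ih =>
    simp only [bellGates, bellStr, List.flatMap_append]
    rw [encode_gatesH (by omega), encode_gatesC (by omega) (by omega) (by omega),
      ih (x + 1) (t + 1) (by omega) (by omega)]

theorem encode_roundGates (w m t : ℕ) (hw : w + m ≤ t) (h2 : 2 ≤ t) (ht : t + 2 + m < M) :
    (roundGates h gs w m t).flatMap Gate.encode =
      roundStr (gs.flatMap Gate.encode) ((inverseGates gs).flatMap Gate.encode) w m t := by
  simp only [roundGates, roundStr, List.flatMap_append]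
  rw [encode_map_castLE, encode_map_castLE, encode_ancillaGates m w (t + 2) (by omega) (by omega),
    encode_gatesF (by omega) (by omega) (by omega) (by omega) (by omega) (by omega),
    encode_gatesF (by omega) (by omega) (by omega) (by omega) (by omega) (by omega)]

theorem encode_roundsGates (w m k t : ℕ) (hw : w + m ≤ t) (h2 : 2 ≤ t)
    (ht : t + k * (2 + m) < M) :
    (roundsGates h gs w m k t).flatMap Gate.encode =
      roundsStr (gs.flatMap Gate.encode) ((inverseGates gs).flatMap Gate.encode) w m k t := by
  induction k generalizing t with
  | zero => rfl
  | succ k ih =>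
    rw [add_mul, one_mul] at ht
    simp only [roundsGates, roundsStr, List.flatMap_append]
    rw [encode_roundGates h gs w m t hw h2 (by omega), ih _ (by omega) (by omega) (by omega)]

theorem encode_amplifyGates (w m : ℕ) (h2 : 2 ≤ w + m)
    (hM : w + m + w + (w + 1) * (2 + m) < M) :
    (amplifyGates h gs w m).flatMap Gate.encode =
      amplifyStr (gs.flatMap Gate.encode) ((inverseGates gs).flatMap Gate.encode) w m := by
  simp only [amplifyGates, amplifyStr, List.flatMap_append]
  rw [encode_bellGates _ _ _ (by omega) (by omega), encode_gatesX (by omega),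
    encode_roundsGates h gs w m _ _ (by omega) (by omega) (by omega),
    encode_gatesC (by omega) (by omega) (by omega), encode_gatesC (by omega) (by omega) (by omega)]

end GatesAt

/-- Many rounds of a circuit and its inverse with postselection, on one half of Bell pairs. -/
def amplify (C : Circuit) : Circuit where
  witness := 0
  -- The qubits of `C`, the Bell partners of the witness qubits, `2 + C.ancilla` chain qubits for
  -- each of `C.witness + 1` rounds, and the initial chain qubit.
  ancilla := C.witness + C.ancilla + C.witness + (C.witness + 1) * (2 + C.ancilla) + 1
  two_le := by have := C.two_le; omega
  gates := amplifyGates (by omega) C.gates C.witness C.ancilla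

theorem encode_amplify (C : Circuit) : (amplify C).encode =
    encodeNat 0 ++ encodeNat (C.witness + C.ancilla + C.witness +
      (C.witness + 1) * (2 + C.ancilla) + 1) ++ amplifyStr (C.gates.flatMap Gate.encode)
        ((inverseGates C.gates).flatMap Gate.encode) C.witness C.ancilla := by
  rw [← encode_amplifyGates (M := 0 + (C.witness + C.ancilla + C.witness +
    (C.witness + 1) * (2 + C.ancilla) + 1)) (by omega) C.gates C.witness C.ancilla C.two_le
    (by omega)]
  rfl

/-! ### The state of the amplified circuit -/

section Chain

variable {N M : ℕ}

open scoped Classical in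
/-- The component of a vector in a set of basis states. -/
noncomputable def restrict (p : (Fin N → Bool) → Prop) (u : Vec N) : Vec N :=
  fun a => if p a then u a else 0

open scoped Classical in
/-- The qubits from `N + w` on are a chain, whose last qubit that is not untouched is `t`. If one of
the qubits from `t` on is `1`, then the chain up to `t` is `1`, the rest is `0`, and the state of
the first `N` qubits for the value `β` of the next `w` qubits is `G β`. -/
def ChainState (h : N ≤ M) (w t : ℕ) (G : (Fin w → Bool) → Vec N) (v : Vec M) : Prop :=
  ∀ b, (∃ i, t ≤ i ∧ bit b i = true) →
    v b = if ∀ i, N + w ≤ i → bit b i = decide (i ≤ t) then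
      G (fun i => bit b (N + i)) (b ∘ Fin.castLEEmb h) else 0

variable {h : N ≤ M} {w t : ℕ} {G : (Fin w → Bool) → Vec N} {v : Vec M}

theorem run_zero (gs : List (Gate N)) : run gs 0 = 0 := by
  rw [run_eq_listMatrix_mulVec, mulVec_zero]

-- The gates change only the first `N` bits, while the condition and the chain pattern involve only
-- later ones. So the pattern is a constant factor 1 or 0, and linearity gives the claim.
open scoped Classical in
theorem ChainState.run_map (hv : ChainState h w t G v) (ht : N ≤ t) (gs : List (Gate N)) :
    ChainState h w t (fun β => run gs (G β)) (run (gs.map (Gate.map (Fin.castLEEmb h))) v) := by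
  rintro b ⟨i, hi, hb⟩
  have h_bit : ∀ a j, N ≤ j → bit (extend (Fin.castLEEmb h) a b) j = bit b j := by
    intro a j hj
    rw [bit_extend, if_neg (by omega)]
  have h_beta : ∀ a, (fun i : Fin w => bit (extend (Fin.castLEEmb h) a b) (N + i)) =
      fun i : Fin w => bit b (N + i) := fun a => funext fun i => h_bit a _ (by omega)
  have h_v : ∀ a, v (extend (Fin.castLEEmb h) a b) =
      if ∀ i, N + w ≤ i → bit b i = decide (i ≤ t) then G (fun i => bit b (N + i)) a else 0 := by
    intro a
    rw [hv _ ⟨i, hi, by rw [h_bit a i (by omega), hb]⟩, h_beta]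
    have h₁ : extend (Fin.castLEEmb h) a b ∘ Fin.castLEEmb h = a :=
      funext fun i => (Fin.castLEEmb h).injective.extend_apply ..
    rw [h₁]
    refine if_congr (forall₂_congr fun i hi => ?_) rfl rfl
    rw [h_bit a i (by omega)]
  rw [MerlinQC.run_map]
  simp only [h_v]
  split_ifs
  · rfl
  · exact congrFun (run_zero gs) _

theorem gatesX_eq_map (h : N ≤ M) {q : ℕ} (hq : q < N) :
    gatesX M q = (gatesX N q).map (Gate.map (Fin.castLEEmb h)) := by
  simp [gatesX, hq, hq.trans_le h, Gate.map]

/-- If the chain bit `t` and the tested bit are both `1`, the gate flips bit `t + 1`, which turns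
the pattern for `t` into that for `t + 1`. Otherwise `b` is fixed by the gate; having a `1` beyond
`t`, it violates the old pattern, so its amplitude is 0, as the new state demands. -/
theorem ChainState.run_gatesF (hv : ChainState h w t G v) (ht : N + w ≤ t) (htM : t + 1 < M)
    {q : ℕ} (hq : q < N) :
    ChainState h w (t + 1) (fun β => restrict (fun a => bit a q = true) (G β))
      (run (gatesF M t q (t + 1)) v) := by
  rintro b ⟨i, hi, hb⟩
  rw [MerlinQC.run_gatesF (by omega) (by omega) htM (by omega) (by omega) (by omega)]
  set b' := setBit b (t + 1) (xor (bit b (t + 1)) (bit b t && bit b q)) with hb'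
  have h_bit : ∀ j, bit b' j =
      if j = t + 1 then xor (bit b (t + 1)) (bit b t && bit b q) else bit b j := fun j =>
    bit_setBit b htM _ j
  simp only [restrict, bit_comp_castLE h b hq]
  by_cases hc : (bit b t && bit b q) = true
  · obtain ⟨hbt, hbq⟩ := Bool.and_eq_true_iff.1 hc
    have h₁ : b' ∘ Fin.castLEEmb h = b ∘ Fin.castLEEmb h := by
      refine bit_ext fun j => ?_
      by_cases hj : j < N
      · rw [bit_comp_castLE h _ hj, bit_comp_castLE h _ hj, h_bit, if_neg (by omega)]
      · rw [bit_of_le _ (by omega), bit_of_le _ (by omega)]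
    have h₂ : (fun i : Fin w => bit b' (N + i)) = fun i : Fin w => bit b (N + i) :=
      funext fun i => by rw [h_bit, if_neg (by omega)]
    rw [hv b' ⟨t, le_rfl, by rw [h_bit, if_neg (by omega), hbt]⟩, h₁, h₂, if_pos hbq]
    congr 1
    refine propext (forall₂_congr fun j hj => ?_)
    rw [h_bit, hc]
    by_cases hj' : j = t + 1
    · subst hj'
      simp
    · rw [if_neg hj']
      have : j ≤ t ↔ j ≤ t + 1 := by omega
      simp [this]
  · have h₁ : b' = b := by
      rw [hb', Bool.eq_false_iff.2 hc, Bool.xor_false, setBit_bit]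
    rw [h₁, hv b ⟨i, by omega, hb⟩, if_neg]
    · split_ifs with h₂ h₃
      · refine absurd ?_ hc
        rw [h₂ t ht, h₃]
        simp
      · rfl
      · rfl
    · intro h₂
      have := h₂ i (by omega)
      rw [hb] at this
      simp at this
      omega

theorem restrict_restrict (p p' : (Fin N → Bool) → Prop) (u : Vec N) :
    restrict p (restrict p' u) = restrict (fun a => p a ∧ p' a) u := by
  funext a
  simp only [restrict]
  split_ifs <;> simp_all

theorem run_gatesX_restrict {q : ℕ} (hq : q < N) (u : Vec N) :
    run (gatesX N q) (restrict (fun a => bit a q = true) (run (gatesX N q) u)) =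
      restrict (fun a => bit a q = false) u := by
  funext a
  rw [run_gatesX hq]
  simp only [restrict, run_gatesX hq]
  have h₁ : setBit (setBit a q (!bit a q)) q (!bit (setBit a q (!bit a q)) q) = a := by
    refine bit_ext fun j => ?_
    simp only [bit_setBit _ hq]
    split_ifs with hj
    · simp [hj]
    · rfl
  rw [h₁, bit_setBit _ hq, if_pos rfl]
  simp

/-- Each tested qubit consumes one chain qubit, and conjugation by `X` makes the test one for `0`.
Successive restrictions intersect. -/
theorem ChainState.run_ancillaGates (a x : ℕ) (hx : x + a ≤ N) (hv : ChainState h w t G v)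
    (ht : N + w ≤ t) (htM : t + a < M) :
    ChainState h w (t + a)
      (fun β => restrict (fun c => ∀ i, x ≤ i → i < x + a → bit c i = false) (G β))
      (run (ancillaGates M a x t) v) := by
  induction a generalizing x t G v with
  | zero =>
    have : (fun β => restrict (fun c => ∀ i, x ≤ i → i < x + 0 → bit c i = false) (G β)) = G := by
      funext β c
      simp only [restrict]
      rw [if_pos fun i hi hi' => by omega]
    rw [this]
    exact hv
  | succ a ih =>
    have hq : x < N := by omega
    have h₁ := ((hv.run_map (by omega) (gatesX N x)).run_gatesF ht (by omega) hq).run_map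
      (by omega) (gatesX N x)
    simp only [← gatesX_eq_map h hq, run_gatesX_restrict hq] at h₁
    have h₂ := ih (x + 1) (by omega) h₁ (by omega) (by omega)
    simp only [restrict_restrict] at h₂
    simp only [ancillaGates, run_append]
    convert h₂ using 1
    · omega
    · funext β
      congr 1
      funext c
      refine propext ⟨fun H => ⟨fun i hi hi' => H i (by omega) (by omega), H x le_rfl (by omega)⟩,
        fun H i hi hi' => ?_⟩
      rcases eq_or_lt_of_le hi with rfl | hi
      · exact H.2
      · exact H.1 i (by omega) (by omega)

/-- One round of postselection, as an operation on the state of the circuit. -/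
noncomputable def roundVec (gs : List (Gate N)) (w m : ℕ) (u : Vec N) : Vec N :=
  restrict (fun c => ∀ i, w ≤ i → i < w + m → bit c i = false)
    (run (inverseGates gs) (restrict (fun c => bit c 1 = true ∧ bit c 0 = true) (run gs u)))

theorem ChainState.run_roundGates (gs : List (Gate N)) (m : ℕ) (hm : w + m ≤ N) (h2 : 2 ≤ N)
    (hv : ChainState h w t G v) (ht : N + w ≤ t) (htM : t + 2 + m < M) :
    ChainState h w (t + 2 + m) (fun β => roundVec gs w m (G β))
      (run (roundGates h gs w m t) v) := by
  have h₁ := ((((hv.run_map (by omega) gs).run_gatesF (q := 0) ht (by omega) (by omega)).run_gatesF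
    (q := 1) (by omega) (by omega) (by omega)).run_map (by omega) (inverseGates gs)).run_ancillaGates
    m w (by omega) (by omega) (by omega)
  simp only [restrict_restrict] at h₁
  simp only [roundGates, run_append]
  exact h₁

theorem ChainState.run_roundsGates (gs : List (Gate N)) (m k : ℕ) (hm : w + m ≤ N) (h2 : 2 ≤ N)
    (hv : ChainState h w t G v) (ht : N + w ≤ t) (htM : t + k * (2 + m) < M) :
    ChainState h w (t + k * (2 + m)) (fun β => (roundVec gs w m)^[k] (G β))
      (run (roundsGates h gs w m k t) v) := by
  induction k generalizing t G v with
  | zero => simpa [roundsGates] using hv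
  | succ k ih =>
    rw [add_mul, one_mul] at htM
    have := ih (hv.run_roundGates gs m hm h2 ht (by omega)) (by omega) (by omega)
    simp only [roundsGates, run_append]
    convert this using 1
    · ring
    · rfl

end Chain

end MerlinQC

/-! ### The acceptance probability of the amplified circuit -/

namespace MerlinQC

open Matrix Function
open scoped ComplexOrder

/-! ### Traces of powers of a positive operator -/

section Trace

variable {n : Type*} [Fintype n] [DecidableEq n]

theorem exists_diagonalization {A : Matrix n n ℂ} (hA : A.PosSemidef) :
    ∃ (V : Matrix n n ℂ) (l : n → ℝ), Vᴴ * V = 1 ∧ V * Vᴴ = 1 ∧ (∀ i, 0 ≤ l i) ∧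
      A = V * diagonal (fun i => (l i : ℂ)) * Vᴴ := by
  refine ⟨hA.1.eigenvectorUnitary, hA.1.eigenvalues, ?_, ?_, hA.eigenvalues_nonneg, ?_⟩
  · exact Unitary.coe_star_mul_self hA.1.eigenvectorUnitary
  · exact Unitary.coe_mul_star_self hA.1.eigenvectorUnitary
  · exact hA.1.spectral_theorem

theorem conj_diagonal_pow {V : Matrix n n ℂ} (hV : Vᴴ * V = 1) (hV' : V * Vᴴ = 1) (l : n → ℝ)
    (k : ℕ) : (V * diagonal (fun i => (l i : ℂ)) * Vᴴ) ^ k =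
      V * diagonal (fun i => (l i : ℂ) ^ k) * Vᴴ := by
  induction k with
  | zero => simp [hV']
  | succ k ih =>
    rw [pow_succ, ih]
    calc _ = V * diagonal (fun i => (l i : ℂ) ^ k) * (Vᴴ * V) * diagonal (fun i => (l i : ℂ)) * Vᴴ :=
          by noncomm_ring
      _ = _ := by
        rw [hV, mul_one, mul_assoc V, diagonal_mul_diagonal]
        simp only [pow_succ]

theorem trace_conj_diagonal {V : Matrix n n ℂ} (l : n → ℂ) (B : Matrix n n ℂ) :
    (V * diagonal l * Vᴴ * B).trace = ∑ i, l i * (Vᴴ * B * V) i i := by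
  rw [mul_assoc, mul_assoc, trace_mul_comm, mul_assoc]
  simp [Matrix.trace, diagonal_mul]

/-- In an eigenbasis of `A`, the number `tr (A ψ)` is an average of the eigenvalues weighted by the
diagonal of `ψ`. So some eigenvalue is at least `x`, and its power alone bounds the trace from
below. -/
theorem re_trace_pow_ge {A ψ : Matrix n n ℂ} (hA : A.PosSemidef) (hψ : ψ.PosSemidef)
    (h1 : ψ.trace = 1) {x : ℝ} (hx : 0 ≤ x) (h : x ≤ (A * ψ).trace.re) (k : ℕ) :
    x ^ k ≤ (A ^ k).trace.re := by
  obtain ⟨V, l, hV, hV', hl, rfl⟩ := exists_diagonalization hA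
  have hp : ∀ i, 0 ≤ ((Vᴴ * ψ * V) i i).re := fun i =>
    (Complex.le_def.1 (hψ.conjTranspose_mul_mul_same V).diag_nonneg).1
  have hs : ∑ i, ((Vᴴ * ψ * V) i i).re = 1 := by
    have : (Vᴴ * ψ * V).trace = 1 := by
      rw [trace_mul_comm, ← mul_assoc, hV', one_mul, h1]
    rw [← Complex.re_sum]
    exact congrArg Complex.re this
  rw [trace_conj_diagonal, Complex.re_sum] at h
  simp only [Complex.re_ofReal_mul] at h
  obtain ⟨i, hi⟩ : ∃ i, x ≤ l i := by
    by_contra! hlt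
    have hex : ∃ i, 0 < ((Vᴴ * ψ * V) i i).re := by
      by_contra! hle
      have := Finset.sum_nonpos fun i (_ : i ∈ Finset.univ) => hle i
      linarith
    obtain ⟨i, hi⟩ := hex
    have : ∑ i, l i * ((Vᴴ * ψ * V) i i).re < ∑ i, x * ((Vᴴ * ψ * V) i i).re :=
      Finset.sum_lt_sum (fun j _ => mul_le_mul_of_nonneg_right (hlt j).le (hp j))
        ⟨i, Finset.mem_univ i, mul_lt_mul_of_pos_right (hlt i) hi⟩
    rw [← Finset.mul_sum, hs] at this
    linarith
  rw [conj_diagonal_pow hV hV', ← mul_one (V * _ * Vᴴ), trace_conj_diagonal, mul_one, hV,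
    Complex.re_sum]
  simp only [one_apply_eq, mul_one, ← Complex.ofReal_pow, Complex.ofReal_re]
  exact (pow_le_pow_left₀ hx hi k).trans
    (Finset.single_le_sum (f := fun i => l i ^ k) (fun i _ => pow_nonneg (hl i) k)
      (Finset.mem_univ i))

/-- Taking for `ξ` the projection to an eigenvector shows that every eigenvalue is at most `x`; the
trace adds up as many powers as the dimension. -/
theorem re_trace_pow_le {A : Matrix n n ℂ} (hA : A.PosSemidef) {x : ℝ}
    (h : ∀ ξ : Matrix n n ℂ, ξ.PosSemidef → ξ.trace = 1 → (A * ξ).trace.re ≤ x) (k : ℕ) :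
    (A ^ k).trace.re ≤ Fintype.card n * x ^ k := by
  obtain ⟨V, l, hV, hV', hl, rfl⟩ := exists_diagonalization hA
  have hi : ∀ i, l i ≤ x := by
    intro i
    have hE : (Matrix.single i i (1 : ℂ)).PosSemidef := by
      rw [← diagonal_single]
      refine PosSemidef.diagonal fun j => ?_
      by_cases hj : j = i
      · subst hj
        simp
      · simp [hj]
    have := h _ (hE.mul_mul_conjTranspose_same V)
      (by rw [trace_mul_comm, ← mul_assoc, hV, one_mul, trace_single_eq_same])
    have e : Vᴴ * (V * Matrix.single i i (1 : ℂ) * Vᴴ) * V = Matrix.single i i 1 := by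
      calc _ = (Vᴴ * V) * Matrix.single i i (1 : ℂ) * (Vᴴ * V) := by noncomm_ring
        _ = _ := by rw [hV, one_mul, mul_one]
    rw [trace_conj_diagonal, e, Finset.sum_eq_single i] at this
    · simpa using this
    · intro j _ hj
      simp [single_apply_of_ne, hj.symm]
    · simp
  rw [conj_diagonal_pow hV hV', ← mul_one (V * _ * Vᴴ), trace_conj_diagonal, mul_one, hV,
    Complex.re_sum]
  simp only [one_apply_eq, mul_one, ← Complex.ofReal_pow, Complex.ofReal_re]
  calc _ ≤ ∑ _i : n, x ^ k := Finset.sum_le_sum fun i _ => pow_le_pow_left₀ (hl i) (hi i) k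
    _ = _ := by simp

omit [DecidableEq n] in
theorem sum_normSq_eq_trace {m : Type*} [Fintype m] (B : Matrix m n ℂ) :
    ∑ j, ∑ i, Complex.normSq (B i j) = (Bᴴ * B).trace.re := by
  simp only [Matrix.trace, Matrix.diag_apply, mul_apply, conjTranspose_apply, Complex.re_sum]
  refine Finset.sum_congr rfl fun j _ => Finset.sum_congr rfl fun i _ => ?_
  rw [Complex.star_def, ← Complex.normSq_eq_conj_mul_self, Complex.ofReal_re]

end Trace

/-! ### Preparation of the Bell pairs -/

section Initial

variable {N M : ℕ}

/-- The vector of the state `|0…0⟩`. -/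
noncomputable def zeroVec (M : ℕ) : Vec M := Pi.single (fun _ => false) 1

open scoped Classical in
/-- The product of `x` Bell pairs, with all further qubits `0`. -/
noncomputable def bellVec (M N x : ℕ) : Vec M := fun b =>
  if (∀ i, x ≤ i → i < N → bit b i = false) ∧ (∀ i, i < x → bit b (N + i) = bit b i) ∧
    (∀ i, N + x ≤ i → bit b i = false) then (((Real.sqrt 2)⁻¹ : ℝ) : ℂ) ^ x else 0

theorem bellVec_zero : bellVec M N 0 = zeroVec M := by
  funext b
  unfold bellVec zeroVec
  by_cases hb : b = fun _ => false
  · subst hb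
    rw [Pi.single_eq_same, if_pos, pow_zero]
    simp [bit]
  · rw [Pi.single_eq_of_ne hb, if_neg]
    rintro ⟨h₁, -, h₂⟩
    refine hb (funext fun i => ?_)
    rw [← bit_val b i]
    by_cases hi : (i : ℕ) < N
    · exact h₁ i (by omega) hi
    · exact h₂ i (by omega)

open scoped Classical in
theorem run_bell_step {x : ℕ} (hx : x < N) (hM : N + x < M) :
    run (gatesH M x ++ gatesC M x (N + x)) (bellVec M N x) = bellVec M N (x + 1) := by
  funext b
  rw [run_append, run_gatesC (by omega) hM (by omega), run_gatesH (by omega)]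
  set b₁ := setBit b (N + x) (xor (bit b (N + x)) (bit b x)) with hb₁
  have h_bit : ∀ y j, bit (setBit b₁ x y) j = if j = x then y else
      if j = N + x then xor (bit b (N + x)) (bit b x) else bit b j := by
    intro y j
    rw [bit_setBit _ (by omega), hb₁, bit_setBit _ hM]
  -- Qubit `x` is still `0` before the Hadamard gate, so only one of the two terms survives, and the
  -- sign plays no role.
  have h₁ : bellVec M N x (setBit b₁ x true) = 0 := by
    unfold bellVec
    rw [if_neg]
    rintro ⟨h, -⟩
    simpa [h_bit] using h x le_rfl hx
  rw [h₁, mul_zero, add_zero]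
  unfold bellVec
  simp only [h_bit, mul_ite, mul_zero, pow_succ']
  refine if_congr ⟨?_, ?_⟩ rfl rfl
  · rintro ⟨h₁, h₂, h₃⟩
    refine ⟨fun i hi hi' => ?_, fun i hi => ?_, fun i hi => ?_⟩
    · have := h₁ i (by omega) hi'
      rwa [if_neg (by omega), if_neg (by omega)] at this
    · rcases eq_or_ne i x with rfl | hne
      · have := h₃ (N + i) le_rfl
        rw [if_neg (by omega), if_pos rfl] at this
        simpa using this
      · have := h₂ i (by omega)
        rwa [if_neg (by omega), if_neg (by omega), if_neg hne, if_neg (by omega)] at this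
    · have := h₃ i (by omega)
      rwa [if_neg (by omega), if_neg (by omega)] at this
  · rintro ⟨h₁, h₂, h₃⟩
    refine ⟨fun i hi hi' => ?_, fun i hi => ?_, fun i hi => ?_⟩
    · split_ifs with h h
      · rfl
      · omega
      · exact h₁ i (by omega) hi'
    · rw [if_neg (by omega), if_neg (by omega), if_neg (by omega), if_neg (by omega)]
      exact h₂ i (by omega)
    · rw [if_neg (by omega)]
      split_ifs with h
      · simpa using h₂ x (by omega)
      · exact h₃ i (by omega)

theorem run_bellGates (a x : ℕ) (hx : x + a ≤ N) (hM : N + x + a ≤ M) :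
    run (bellGates M a x (N + x)) (bellVec M N x) = bellVec M N (x + a) := by
  induction a generalizing x with
  | zero => rfl
  | succ a ih =>
    rw [bellGates, run_append, run_bell_step (by omega) (by omega), add_assoc N,
      ih (x + 1) (by omega) (by omega), show x + 1 + a = x + (a + 1) by ring]

-- Given the value `β` of the partner qubits, the Bell pairs leave the witness qubits in `|β⟩` with
-- amplitude `2^(-w/2)`. The `X` gate starts the chain with a `1`.
open scoped Classical in
theorem chainState_initial (h : N ≤ M) {w : ℕ} (hw : w ≤ N) (hM : N + w < M) :
    ChainState h w (N + w) (fun β a => if (∀ i, w ≤ i → i < N → bit a i = false) ∧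
        (∀ i : Fin w, bit a i = β i) then (((Real.sqrt 2)⁻¹ : ℝ) : ℂ) ^ w else 0)
      (run (gatesX M (N + w)) (run (bellGates M w 0 N) (zeroVec M))) := by
  intro b _
  have := run_bellGates (N := N) (M := M) w 0 (by omega) (by omega)
  rw [add_zero, zero_add, bellVec_zero] at this
  rw [this, run_gatesX hM, bellVec, ← ite_and]
  simp only [bit_setBit _ hM]
  refine if_congr ⟨?_, ?_⟩ rfl rfl
  · rintro ⟨h₁, h₂, h₃⟩
    refine ⟨fun i hi => ?_, fun i hi hi' => ?_, fun i => ?_⟩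
    · have := h₃ i hi
      split_ifs at this with hi'
      · subst hi'
        simpa using this
      · rw [this, eq_comm, decide_eq_false_iff_not]
        omega
    · have := h₁ i hi hi'
      rw [if_neg (by omega)] at this
      rwa [bit_comp_castLE h b hi']
    · have := h₂ i i.2
      rw [if_neg (by omega), if_neg (by omega)] at this
      rw [bit_comp_castLE h b (by omega), this]
  · rintro ⟨h₁, h₂, h₃⟩
    refine ⟨fun i hi hi' => ?_, fun i hi => ?_, fun i hi => ?_⟩
    · rw [if_neg (by omega), ← bit_comp_castLE h b hi']
      exact h₂ i hi hi'
    · rw [if_neg (by omega), if_neg (by omega), ← bit_comp_castLE h b (show i < N by omega)]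
      exact (h₃ ⟨i, hi⟩).symm
    · have := h₁ i hi
      split_ifs with hi'
      · subst hi'
        simpa using this
      · rw [this, decide_eq_false_iff_not]
        omega

end Initial

/-! ### Reading off the last chain qubit -/

section Final

variable {N M : ℕ}

theorem involutive_setBit_xor {c t : ℕ} (ht : t < M) (h : c ≠ t) :
    Involutive fun b : Fin M → Bool => setBit b t (xor (bit b t) (bit b c)) := by
  intro b
  refine bit_ext fun i => ?_
  simp only [bit_setBit _ ht]
  by_cases hi : i = t
  · subst hi
    simp [h]
  · simp [hi]

/-- The two controlled-not gates permute the basis states so that qubit 0 receives the former value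
of qubit `t`; the sum is reindexed along this permutation. -/
theorem sum_run_swap {t : ℕ} (ht : t < M) (h : t ≠ 0) (v : Vec M) :
    ∑ b, (if bit b 0 = true then
        Complex.normSq (run (gatesC M t 0) (run (gatesC M 0 t) v) b) else 0) =
      ∑ b, if bit b t = true then Complex.normSq (v b) else 0 := by
  have h0 : 0 < M := by omega
  set σ := (involutive_setBit_xor ht h.symm).toPerm with hσ
  set τ := (involutive_setBit_xor h0 h).toPerm with hτ
  set F : (Fin M → Bool) → ℝ := fun b => if bit b t = true then Complex.normSq (v b) else 0 with hF
  refine Eq.trans (Finset.sum_congr rfl fun b _ => ?_)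
    ((Equiv.sum_comp τ fun b => F (σ b)).trans (Equiv.sum_comp σ F))
  rw [run_gatesC ht h0 h, run_gatesC h0 ht h.symm]
  have e : bit (σ (τ b)) t = bit b 0 := by
    rw [hσ, hτ, Involutive.coe_toPerm, Involutive.coe_toPerm, bit_setBit _ ht, if_pos rfl,
      bit_setBit _ h0, if_neg h, bit_setBit _ h0, if_pos rfl]
    cases bit b t <;> cases bit b 0 <;> rfl
  simp only [hF, e]
  rfl

/-- When `t` is the last qubit, every basis state with bit `t` set falls under the invariant. Its
amplitude vanishes unless the whole chain is `1`, and then it is determined by `β` and the first `N`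
bits. -/
theorem ChainState.sum_normSq {h : N ≤ M} {w t : ℕ} {G : (Fin w → Bool) → Vec N} {v : Vec M}
    (hv : ChainState h w t G v) (ht : N + w ≤ t) (hM : M = t + 1) :
    ∑ b, (if bit b t = true then Complex.normSq (v b) else 0) =
      ∑ β, ∑ a, Complex.normSq (G β a) := by
  rw [← Fintype.sum_prod_type']
  symm
  set e : (Fin w → Bool) × (Fin N → Bool) → Fin M → Bool := fun x i =>
    if i < N then bit x.2 i else if i < N + w then bit x.1 (i - N) else true with he
  have h_bit : ∀ x i, bit (e x) i = if i < N then bit x.2 i else if i < N + w then bit x.1 (i - N)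
      else decide (i ≤ t) := by
    intro x i
    rw [bit]
    split_ifs with h₁ h₂ h₃ h₂ h₃
    · simp [he, h₂]
    · simp [he, h₂, h₃]
    · simp [he, h₂, h₃]
      omega
    · omega
    · omega
    · rw [eq_comm, decide_eq_false_iff_not]
      omega
  have h_fst : ∀ x, (fun i : Fin w => bit (e x) (N + i)) = x.1 := by
    intro x
    funext i
    rw [h_bit, if_neg (by omega), if_pos (by omega), Nat.add_sub_cancel_left, bit_val]
  have h_snd : ∀ x, e x ∘ Fin.castLEEmb h = x.2 := by
    intro x
    funext i
    rw [← bit_val (e x ∘ Fin.castLEEmb h) i, bit_comp_castLE h _ i.2, h_bit, if_pos i.2, bit_val]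
  refine Fintype.sum_of_injective e ?_ _ _ ?_ ?_
  · intro x y hxy
    refine Prod.ext ?_ ?_
    · rw [← h_fst x, ← h_fst y, hxy]
    · rw [← h_snd x, ← h_snd y, hxy]
  · intro b hb
    by_cases hbt : bit b t = true
    · rw [if_pos hbt, hv b ⟨t, le_rfl, hbt⟩, if_neg, Complex.normSq_zero]
      intro hp
      refine hb ⟨(fun i => bit b (N + i), b ∘ Fin.castLEEmb h), bit_ext fun i => ?_⟩
      rw [h_bit]
      split_ifs with h₁ h₂
      · exact bit_comp_castLE h b h₁
      · have := bit_val (fun i : Fin w => bit b (N + i)) ⟨i - N, by omega⟩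
        simp only at this
        rw [this, Nat.add_sub_cancel' (by omega)]
      · exact (hp i (by omega)).symm
    · rw [if_neg hbt]
  · intro x
    have hbt : bit (e x) t = true := by
      rw [h_bit, if_neg (by omega), if_neg (by omega)]
      simp
    rw [if_pos hbt, hv _ ⟨t, le_rfl, hbt⟩, if_pos, h_fst, h_snd]
    intro i hi
    rw [h_bit, if_neg (by omega), if_neg (by omega)]

end Final

end MerlinQC

/-! ### The inclusion -/

namespace MerlinQC

open Matrix Function
open scoped ComplexOrder

/-! ### A round as an operator on witnesses -/

section Embedding

variable {w m : ℕ}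

/-- The isometry that adds `m` qubits in the state `|0⟩`. -/
noncomputable def embedding (w m : ℕ) : Matrix (Fin (w + m) → Bool) (Fin w → Bool) ℂ :=
  Matrix.of fun b a => if ∀ j, b (Fin.natAdd w j) = false then
    (if a = fun i => b (Fin.castAdd m i) then 1 else 0) else 0

theorem embedding_mulVec (x : Vec w) (b : Fin (w + m) → Bool) :
    (embedding w m *ᵥ x) b = if ∀ j, b (Fin.natAdd w j) = false then
      x (fun i => b (Fin.castAdd m i)) else 0 := by
  simp only [mulVec, dotProduct, embedding, of_apply]
  split_ifs <;> simp

theorem append_castAdd_false {b : Fin (w + m) → Bool} (hb : ∀ j, b (Fin.natAdd w j) = false) :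
    Fin.append (fun i => b (Fin.castAdd m i)) (fun _ => false) = b := by
  funext i
  refine Fin.addCases (fun i => ?_) (fun j => ?_) i
  · rw [Fin.append_left]
  · rw [Fin.append_right, hb]

theorem embedding_conjTranspose_mulVec (u : Vec (w + m)) (a : Fin w → Bool) :
    ((embedding w m)ᴴ *ᵥ u) a = u (Fin.append a fun _ => false) := by
  simp only [mulVec, dotProduct, embedding, conjTranspose_apply, of_apply]
  rw [Finset.sum_eq_single (Fin.append a fun _ => false)]
  · simp
  · intro b _ hb
    split_ifs with h₁ h₂
    · exact absurd (h₂ ▸ (append_castAdd_false h₁).symm) hb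
    · simp
    · simp
  · simp

theorem embedding_conjTranspose_mul_self : (embedding w m)ᴴ * embedding w m = 1 := by
  refine Op.ext_mulVec fun v b => ?_
  rw [← mulVec_mulVec, embedding_conjTranspose_mulVec, embedding_mulVec, one_mulVec, if_pos]
  · simp
  · simp

theorem ancilla_iff (b : Fin (w + m) → Bool) :
    (∀ i, w ≤ i → i < w + m → bit b i = false) ↔ ∀ j, b (Fin.natAdd w j) = false := by
  refine ⟨fun H j => ?_, fun H i hi hi' => ?_⟩
  · rw [← bit_val b]
    exact H _ (by simp) (by simp)
  · have := bit_val b (Fin.natAdd w ⟨i - w, by omega⟩)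
    rw [H] at this
    simpa [Nat.add_sub_cancel' hi] using this

theorem restrict_ancilla_eq (u : Vec (w + m)) :
    restrict (fun c => ∀ i, w ≤ i → i < w + m → bit c i = false) u =
      (embedding w m * (embedding w m)ᴴ) *ᵥ u := by
  funext b
  rw [← mulVec_mulVec, embedding_mulVec, embedding_conjTranspose_mulVec, restrict]
  have := ancilla_iff b
  by_cases hb : ∀ j, b (Fin.natAdd w j) = false
  · rw [if_pos (this.2 hb), if_pos hb, append_castAdd_false hb]
  · rw [if_neg (fun h => hb (this.1 h)), if_neg hb]

/-- The projection to the basis states whose first two bits are `1`. -/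
noncomputable def postProj (N : ℕ) : Op N :=
  diagonal fun b => if bit b 1 = true ∧ bit b 0 = true then 1 else 0

theorem restrict_post_eq {N : ℕ} (u : Vec N) :
    restrict (fun c => bit c 1 = true ∧ bit c 0 = true) u = postProj N *ᵥ u := by
  funext b
  rw [postProj, mulVec_diagonal, restrict]
  split_ifs <;> simp

theorem postProj_conjTranspose_mul_self (N : ℕ) : (postProj N)ᴴ * postProj N = postProj N := by
  rw [postProj, diagonal_conjTranspose, diagonal_mul_diagonal]
  congr 1
  funext b
  simp only [Pi.star_apply]
  split_ifs <;> simp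

variable (gs : List (Gate (w + m)))

/-- The acceptance operator on witnesses: its expectation is the probability that the first two
bits are `1`. -/
noncomputable def acceptOp (w m : ℕ) (gs : List (Gate (w + m))) : Op w :=
  (postProj (w + m) * listMatrix gs * embedding w m)ᴴ *
    (postProj (w + m) * listMatrix gs * embedding w m)

theorem acceptOp_eq : acceptOp w m gs = (embedding w m)ᴴ * (listMatrix gs)ᴴ * postProj (w + m) *
    listMatrix gs * embedding w m := by
  simp only [acceptOp, conjTranspose_mul, ← Matrix.mul_assoc]
  rw [Matrix.mul_assoc (_ * _) _ (postProj _), postProj_conjTranspose_mul_self]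

theorem acceptOp_posSemidef : (acceptOp w m gs).PosSemidef := posSemidef_conjTranspose_mul_self _

/-- With `E` the embedding, the final projection is `E Eᴴ`, so a round maps `E y` to `E (Eᴴ Uᴴ Π U
E) y`. The unnormalized state stays in the range of `E`, so rounds multiply. -/
theorem roundVec_embedding (y : Vec w) :
    roundVec gs w m (embedding w m *ᵥ y) = embedding w m *ᵥ (acceptOp w m gs *ᵥ y) := by
  rw [roundVec, restrict_ancilla_eq, restrict_post_eq, run_inverseGates,
    run_eq_listMatrix_mulVec, acceptOp_eq]
  simp only [mulVec_mulVec, Matrix.mul_assoc]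

theorem iterate_roundVec_embedding (k : ℕ) (y : Vec w) :
    (roundVec gs w m)^[k] (embedding w m *ᵥ y) = embedding w m *ᵥ ((acceptOp w m gs ^ k) *ᵥ y) := by
  induction k generalizing y with
  | zero => simp
  | succ k ih => rw [iterate_succ_apply, roundVec_embedding, ih, mulVec_mulVec _ (_ ^ k), pow_succ]

/-- The left side is the squared Hilbert–Schmidt norm of `c E A^k`. The factor `Eᴴ E = 1` cancels,
and squaring the norm doubles the exponent. -/
theorem sum_normSq_iterate (k : ℕ) (c : ℂ) :
    ∑ β, ∑ a, Complex.normSq ((roundVec gs w m)^[k] (embedding w m *ᵥ Pi.single β c) a) =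
      Complex.normSq c * ((acceptOp w m gs) ^ (2 * k)).trace.re := by
  have h₁ : ((embedding w m * acceptOp w m gs ^ k)ᴴ * (embedding w m * acceptOp w m gs ^ k)) =
      (acceptOp w m gs) ^ (2 * k) := by
    rw [conjTranspose_mul, Matrix.mul_assoc, ← Matrix.mul_assoc _ (embedding w m),
      embedding_conjTranspose_mul_self, Matrix.one_mul, conjTranspose_pow,
      (acceptOp_posSemidef gs).1.eq, ← pow_add, two_mul]
  rw [← h₁, ← sum_normSq_eq_trace, Finset.mul_sum]
  refine Finset.sum_congr rfl fun β _ => ?_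
  rw [Finset.mul_sum]
  refine Finset.sum_congr rfl fun a _ => ?_
  rw [iterate_roundVec_embedding, mulVec_mulVec, mulVec_single]
  simp [mul_comm]

end Embedding

/-! ### Probabilities of circuits as traces -/

theorem Circuit.unitary_eq (C : Circuit) : C.unitary = listMatrix C.gates := rfl

theorem Circuit.input_eq (C : Circuit) (ξ : Op C.witness) :
    C.input ξ = embedding C.witness C.ancilla * ξ * (embedding C.witness C.ancilla)ᴴ := by
  ext b c
  simp only [Circuit.input, zeroState, of_apply, mul_apply, embedding, conjTranspose_apply]
  by_cases hb : ∀ j, b (Fin.natAdd C.witness j) = false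
  · by_cases hc : ∀ j, c (Fin.natAdd C.witness j) = false
    · simp [hb, hc]
    · simp [hc]
  · simp [hb]

theorem Circuit.o_eq (C : Circuit) (b : Fin C.width → Bool) : C.o b = bit b 0 :=
  (bit_val b ⟨0, _⟩).symm

theorem Circuit.p_eq (C : Circuit) (b : Fin C.width → Bool) : C.p b = bit b 1 :=
  (bit_val b ⟨1, _⟩).symm

theorem Circuit.prob_input (C : Circuit) (ξ : Op C.witness) :
    C.prob (C.input ξ) (fun b => C.o b && C.p b) =
      (acceptOp C.witness C.ancilla C.gates * ξ).trace.re := by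
  have h₁ : C.prob (C.input ξ) (fun b => C.o b && C.p b) =
      (postProj C.width * (C.unitary * C.input ξ * C.unitaryᴴ)).trace.re := by
    rw [Circuit.prob, Matrix.trace]
    congr 1
    refine Finset.sum_congr rfl fun b _ => ?_
    rw [Matrix.diag_apply, postProj, diagonal_mul, C.o_eq, C.p_eq]
    simp only [Bool.and_eq_true, and_comm, ite_mul, one_mul, zero_mul]
  have h₂ : postProj C.width * (C.unitary * C.input ξ * C.unitaryᴴ) =
      (postProj C.width * C.unitary * embedding C.witness C.ancilla * ξ) *
        ((embedding C.witness C.ancilla)ᴴ * C.unitaryᴴ) := by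
    rw [C.input_eq]
    simp only [Matrix.mul_assoc]
  rw [h₁, h₂, trace_mul_comm, acceptOp_eq, C.unitary_eq]
  simp only [Matrix.mul_assoc]

theorem Circuit.acceptProb_eq (C : Circuit) : C.acceptProb =
    ∑ b, if bit b 0 = true then Complex.normSq (run C.gates (zeroVec C.width) b) else 0 := by
  rw [Circuit.acceptProb, Circuit.prob, Complex.re_sum]
  refine Finset.sum_congr rfl fun b _ => ?_
  rw [C.o_eq]
  split_ifs
  · have : zeroState C.width = vecMulVec (zeroVec C.width) (star (zeroVec C.width)) := by
      ext b c
      simp only [zeroState, of_apply, vecMulVec_apply, zeroVec, Pi.star_apply, Pi.single_apply,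
        funext_iff, ite_and]
      split_ifs <;> simp
    rw [C.unitary_eq, this, mul_vecMulVec, vecMulVec_mul, ← star_mulVec,
      ← run_eq_listMatrix_mulVec, vecMulVec_apply, Pi.star_apply, Complex.star_def, Complex.mul_conj,
      Complex.ofReal_re]
  · rfl

/-- Acceptance means that the last chain qubit is `1`. Summing over the values of the partner qubits
averages over a basis of witnesses, which is the maximally mixed witness. -/
theorem Circuit.acceptProb_amplify (C : Circuit) : (amplify C).acceptProb =
    (1 / 2) ^ C.witness *
      (acceptOp C.witness C.ancilla C.gates ^ (2 * (C.witness + 1))).trace.re := by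
  obtain ⟨w, m, h2, gs⟩ := C
  simp only at gs h2 ⊢
  rw [Circuit.acceptProb_eq]
  set M := (amplify ⟨w, m, h2, gs⟩).width with hM
  have hM' : M = w + m + w + (w + 1) * (2 + m) + 1 := by
    rw [hM]
    exact Nat.zero_add _
  have hNM : w + m ≤ M := by omega
  change ∑ b, (if bit b 0 = true then
    Complex.normSq (run (amplifyGates hNM gs w m) (zeroVec M) b) else 0) = _
  simp only [amplifyGates, run_append]
  rw [sum_run_swap (by omega) (by omega)]
  have h := (chainState_initial hNM (w := w) (by omega) (by omega)).run_roundsGates gs m (w + 1)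
    le_rfl h2 le_rfl (by omega)
  rw [h.sum_normSq (by omega) hM']
  have hG : ∀ β : Fin w → Bool, (fun a : Fin (w + m) → Bool =>
      open scoped Classical in if (∀ i, w ≤ i → i < w + m → bit a i = false) ∧
        (∀ i : Fin w, bit a i = β i) then (((Real.sqrt 2)⁻¹ : ℝ) : ℂ) ^ w else 0) =
      embedding w m *ᵥ Pi.single β ((((Real.sqrt 2)⁻¹ : ℝ) : ℂ) ^ w) := by
    intro β
    funext a
    rw [embedding_mulVec, Pi.single_apply, ← ite_and]
    refine if_congr (and_congr (ancilla_iff a) ?_) rfl rfl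
    rw [funext_iff]
    exact forall_congr' fun i => by rw [← bit_val a (Fin.castAdd m i)]; rfl
  simp only [hG]
  rw [sum_normSq_iterate]
  congr 1
  rw [map_pow, Complex.normSq_ofReal, ← mul_inv, Real.mul_self_sqrt (by norm_num), one_div]

/-- `QMA_{postBQP_FP}` is contained in `SBQP`. -/
theorem QMApostBQPFP_subset_SBQP : QMApostBQPFP ⊆ SBQP := by
  rintro L ⟨w, m, s, Q, hQ, hs⟩
  -- Here the exact value of the postselection probability enters: it is the same for all witnesses,
  -- so bounds on conditional probabilities are bounds on the quadratic form of the acceptance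
  -- operator.
  have h_prob : ∀ x, ∀ ξ : Op (Q x).witness, IsState ξ →
      (acceptOp (Q x).witness (Q x).ancilla (Q x).gates * ξ).trace.re =
        (Q x).condProb ξ / 2 ^ s.eval x.length := by
    intro x ξ hξ
    rw [Circuit.condProb, hs x ξ hξ, Circuit.prob_input]
    field_simp
  -- This exponent is the value of `2^(-w) λ^(2(w+1))` at `λ = (1/2) 2^(-s)`, between the two
  -- eigenvalue bounds.
  refine ⟨w + 2 * (w + 1) * (s + 1), amplify ∘ Q, hQ.uniform.amplify amplify encode_amplify,
    fun x => rfl, fun x hx => ?_, fun x hx => ?_⟩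
  all_goals
    simp only [Polynomial.eval_add, Polynomial.eval_mul, Polynomial.eval_one,
      Polynomial.eval_ofNat, Function.comp_apply, Circuit.acceptProb_amplify, ← hQ.witness_eq]
    set W := (Q x).witness
    set S := s.eval x.length
  · obtain ⟨ψ, hψ, h⟩ := hQ.yes x hx
    have h₁ : (2 / 3) / 2 ^ S ≤
        (acceptOp (Q x).witness (Q x).ancilla (Q x).gates * ψ).trace.re := by
      rw [h_prob x ψ hψ]
      gcongr
    have h₂ := re_trace_pow_ge (acceptOp_posSemidef _) hψ.1 hψ.2 (by positivity) h₁ (2 * (W + 1))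
    calc (1 : ℝ) / 2 ^ (W + 2 * (W + 1) * (S + 1))
        = (1 / 2) ^ W * ((1 / 2) / 2 ^ S) ^ (2 * (W + 1)) := by
          rw [div_div, ← pow_succ', ← _root_.one_div_pow, ← _root_.one_div_pow, ← pow_mul, pow_add]
          ring_nf
      _ ≤ (1 / 2) ^ W * ((2 / 3) / 2 ^ S) ^ (2 * (W + 1)) := by
          have : (1 / 2 : ℝ) / 2 ^ S ≤ (2 / 3) / 2 ^ S :=
            div_le_div_of_nonneg_right (by norm_num) (by positivity)
          gcongr ?_ * ?_ ^ _
      _ ≤ _ := by gcongr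
  · have h₁ : ∀ ξ : Op (Q x).witness, ξ.PosSemidef → ξ.trace = 1 →
        (acceptOp (Q x).witness (Q x).ancilla (Q x).gates * ξ).trace.re ≤ (1 / 3) / 2 ^ S := by
      intro ξ hξ hξ'
      rw [h_prob x ξ ⟨hξ, hξ'⟩]
      have := hQ.no x hx ξ ⟨hξ, hξ'⟩
      gcongr
    have h₂ := re_trace_pow_le (acceptOp_posSemidef _) h₁ (2 * (W + 1))
    have h₃ : (Fintype.card (Fin (Q x).witness → Bool) : ℝ) = 2 ^ W := by simp [W]
    rw [h₃] at h₂
    -- The dimension `2^W` cancels the weight of the mixed state, and `(1/3)^2 = 1/9` is relaxed to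
    -- `1/8`. Since `8^(W+1) = 2^(W+1) * 4^(W+1)`, the exponent `W + 1`, the number of rounds,
    -- yields exactly the threshold with its extra factor `1/2`.
    calc _ ≤ (1 / 2 : ℝ) ^ W * (2 ^ W * ((1 / 3) / 2 ^ S) ^ (2 * (W + 1))) := by gcongr
      _ = (1 / 9) ^ (W + 1) * ((1 / 2 ^ S) ^ (2 * (W + 1))) := by
          rw [← mul_assoc, ← mul_pow, div_eq_mul_one_div (1 / 3 : ℝ), mul_pow (1 / 3 : ℝ), pow_mul]
          norm_num
      _ ≤ (1 / 8) ^ (W + 1) * ((1 / 2 ^ S) ^ (2 * (W + 1))) := by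
          gcongr
          norm_num
      _ = 1 / 2 ^ (W + 2 * (W + 1) * (S + 1) + 1) := by
          rw [show (1 / 8 : ℝ) = (1 / 2) ^ 3 by norm_num, ← _root_.one_div_pow, ← _root_.one_div_pow, ← pow_mul,
            ← pow_mul, ← pow_add]
          congr 1
          ring

end MerlinQC

theorem mainTheorem4 : MerlinQC.QMApostBQPFP ⊆ MerlinQC.SBQP := by
  exact MerlinQC.QMApostBQPFP_subset_SBQP
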